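/- Let $X$ be a locally compact Polish space and let $\mathbb R_+^*=(0,\infty)$. A set is called bounded Borel if it is Borel with compact closure. Let $\mathbb K(X)$ be the cone of non-negative discrete Radon measures $\eta=\sum_i s_i\delta_{x_i}$ on $X$ (at most countably many distinct points $x_i\in X$, weights $s_i>0$), with the Borel $\sigma$-algebra of the vague topology; write $\tau(\eta)=\{x:\eta(\{x\})>0\}$ and $s_x=\eta(\{x\})$. Let $\nu$ and $\sigma$ be non-atomic positive Radon measures on $\mathbb R_+^*$ and $X$, respectively, with $$\int_{\mathbb R_+^*}s^n\,d\nu(s)<\infty\qquad\text{for all } n\ge 1 .$$ Let $\pi_{\mathbb K,\nu\otimes\sigma}$ be the probability measure on $\mathbb K(X)$ that is the push-forward, under $\gamma\mapsto\sum_{(s,x)\in\gamma}s\,\delta_x$, of the Poisson measure with intensity $\nu\otimes\sigma$ on the locally finite configurations $\gamma\subset\mathbb R_+^*\times X$ (this map is defined on the set, of full Poisson measure, of those $\gamma$ that have no two points over the same $x$ and satisfy $\sum_{(s,x)\in\gamma,\,x\in\Lambda}s<\infty$ for all bounded Borel $\Lambda$). Let $\mathbb K_0(X)=\{\eta\in\mathbb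 K(X):|\tau(\eta)|<\infty\}$, with the $\sigma$-algebra transported by the same map from the space of finite configurations $\gamma$ in $\mathbb R_+^*\times X$ with no two points over the same $x$ (the space of finite configurations being topologized as the disjoint union over $n$ of the quotients by the symmetric group of the spaces of $n$-tuples of distinct points). A measurable set $A\subset\mathbb K_0(X)$ is bounded if there are $0<a<b$, a bounded Borel $\Lambda\subset X$ and $N\in\mathbb N$ such that every $\xi\in A$ satisfies $\tau(\xi)\subset\Lambda$, $|\tau(\xi)|\le N$ and $s_x(\xi)\in[a,b]$ for all $x\in\tau(\xi)$. The Lebesgue--Poisson measure $\lambda_{\mathbb K_0,\nu\otimes\sigma}$ on $\mathbb K_0(X)$ is given by $$\int G\,d\lambda_{\mathbb K_0,\nu\otimes\sigma}=G(0)+\sum_{n\ge1}\frac1{n!}\int_{(\mathbb R_+^*\times X)^n}G\Bigl(\sum_{k=1}^n s_k\delta_{x_k}\Bigr)\,d\nu(s_1)\cdots d\nu(s_n)\,d\sigma(x_1)\cdots d\sigma(x_n)$$ for measurable $G\ge 0$. Let $\mu$ be a probability measure on $\mathbb K(X)$ such that * $\int\eta(\Lambda)^n\,d\mu(\eta)<\infty$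 for all $n\in\mathbb N$ and all bounded Borel $\Lambda\subset X$; and * $\mu$ is locally absolutely continuous with respect to $\pi_{\mathbb K,\nu\otimes\sigma}$, i.e. for all bounded Borel $\Lambda$ and all $0<a<b$ we have $\mu\circ p_{\Lambda,a,b}^{-1}\ll\pi_{\mathbb K,\nu\otimes\sigma}\circ p_{\Lambda,a,b}^{-1}$, where $p_{\Lambda,a,b}(\eta)=\sum_{x\in\tau(\eta)\cap\Lambda}\mathbf 1_{[a,b]}(s_x)\,s_x\delta_x$. Then there is a unique measure $\rho_\mu$ on $\mathbb K_0(X)$ (the correlation measure of $\mu$) such that $$\rho_\mu(A)=\int_{\mathbb K(X)}\ \sum_{\xi\Subset\eta}\mathbf 1_A(\xi)\,d\mu(\eta)$$ for all bounded measurable $A\subset\mathbb K_0(X)$, where $\xi\Subset\eta$ means that $\xi\in\mathbb K_0(X)$, $\tau(\xi)\subset\tau(\eta)$ and $s_x(\xi)=s_x(\eta)$ for all $x\in\tau(\xi)$. Moreover, $\rho_\mu$ is absolutely continuous with respect to $\lambda_{\mathbb K_0,\nu\otimes\sigma}$, and there is a measurable $k_\mu:\mathbb K_0(X)\to[0,\infty)$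 (the correlation function of $\mu$) with $\rho_\mu=k_\mu\cdot\lambda_{\mathbb K_0,\nu\otimes\sigma}$. -/

import Mathlib

open MeasureTheory Set
open scoped ENNReal NNReal

namespace DiscreteCone

/-- The half-line `(0, ∞)`. Its subspace topology is the topology of the logarithmic metric. -/
abbrev PosReal : Type := Set.Ioi (0 : ℝ)

/-- Borel sets with compact closure. -/
def IsBoundedBorel {Y : Type*} [TopologicalSpace Y] [MeasurableSpace Y] (B : Set Y) : Prop :=
  MeasurableSet B ∧ IsCompact (closure B)

/-- The weights in `[a, b]`. -/
def weightIcc (a b : ℝ) : Set PosReal := {s | a ≤ (s : ℝ) ∧ (s : ℝ) ≤ b}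

section Definitions

variable {X : Type*} [TopologicalSpace X] [MeasurableSpace X]

/-! ### The cone of discrete Radon measures -/

/-- A non-negative discrete Radon measure: it is finite on compact sets and is a countable sum
`∑ s_x δ_x` over distinct points `x` with strictly positive weights. -/
def IsDiscreteRadon (η : Measure X) : Prop :=
  (∀ C : Set X, IsCompact C → η C < ∞) ∧
    ∃ (S : Set X) (w : X → ℝ), S.Countable ∧ (∀ x ∈ S, 0 < w x) ∧
      η = Measure.sum fun x : S => ENNReal.ofReal (w x) • Measure.dirac (x : X)

variable (X) in
/-- The cone `𝕂(X)` of non-negative discrete Radon measures. -/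
structure Cone where
  toMeasure : Measure X
  isDiscreteRadon : IsDiscreteRadon toMeasure

/-- The weight `s_x(η) = η({x})`. -/
noncomputable def Cone.weight (η : Cone X) (x : X) : ℝ := η.toMeasure.real {x}

/-- The support `τ(η) = {x | η({x}) > 0}`. -/
def Cone.supp (η : Cone X) : Set X := {x | 0 < η.toMeasure {x}}

theorem Cone.mem_supp {η : Cone X} {x : X} : x ∈ η.supp ↔ 0 < η.toMeasure {x} := Iff.rfl

/-- The vague topology on `𝕂(X)`: the coarsest one making all `η ↦ ∫ f dη`, with `f` continuous
and compactly supported, continuous. -/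
noncomputable instance Cone.instTopologicalSpace : TopologicalSpace (Cone X) :=
  TopologicalSpace.induced
    (fun η (f : CompactlySupportedContinuousMap X ℝ) => ∫ x, f x ∂η.toMeasure) inferInstance

noncomputable instance Cone.instMeasurableSpace : MeasurableSpace (Cone X) := borel (Cone X)

theorem isDiscreteRadon_of_countable [MeasurableSingletonClass X] {η : Measure X}
    (hfin : ∀ C : Set X, IsCompact C → η C < ∞) {S : Set X} (hS : S.Countable) (h0 : η Sᶜ = 0) :
    IsDiscreteRadon η := by
  have hx : ∀ x, η {x} < ∞ := fun x => hfin _ isCompact_singleton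
  refine ⟨hfin, {x ∈ S | 0 < η {x}}, fun x => (η {x}).toReal, hS.mono (sep_subset _ _), ?_, ?_⟩
  · rintro x ⟨-, h⟩
    exact ENNReal.toReal_pos h.ne' (hx x).ne
  · have hT : ({x ∈ S | 0 < η {x}} : Set X).Countable := hS.mono (sep_subset _ _)
    set T : Set X := {x ∈ S | 0 < η {x}} with hTdef
    have hT0 : η Tᶜ = 0 := by
      have hsub : Tᶜ ⊆ Sᶜ ∪ ⋃ x ∈ S \ T, {x} := by
        intro x hxT
        by_cases hxS : x ∈ S
        · right
          simp only [mem_iUnion]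
          exact ⟨x, ⟨hxS, hxT⟩, rfl⟩
        · exact Or.inl hxS
      refine measure_mono_null hsub (measure_union_null h0 ?_)
      rw [measure_biUnion_null_iff (hS.mono sdiff_subset)]
      rintro x ⟨hxS, hxT⟩
      by_contra hne
      exact hxT ⟨hxS, pos_iff_ne_zero.2 hne⟩
    ext A hA
    have h1 : η A = η (A ∩ T) := (measure_inter_conull hT0).symm
    have h2 : A ∩ T = ⋃ x : T, (A ∩ {(x : X)}) := by
      ext x; simp
    have : Countable T := hT.to_subtype
    rw [h1, h2, measure_iUnion, Measure.sum_apply _ hA]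
    · refine tsum_congr fun x => ?_
      rw [ENNReal.ofReal_toReal (hx x).ne, Measure.smul_apply, Measure.dirac_apply' _ hA]
      by_cases hxA : (x : X) ∈ A
      · simp [hxA]
      · simp [hxA]
    · intro x y hxy
      refine Set.disjoint_left.2 ?_
      rintro z ⟨-, rfl⟩ ⟨-, h⟩
      exact hxy (Subtype.ext h)
    · exact fun x => hA.inter (measurableSet_singleton _)

/-- The projection `p_{Λ,a,b}(η) = ∑_{x ∈ τ(η) ∩ Λ} 1_{[a,b]}(s_x) s_x δ_x`, which is the restriction
of `η` to the points of `Λ` with weight in `[a, b]`. -/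
noncomputable def Cone.proj [MeasurableSingletonClass X] (Λ : Set X) (a b : ℝ) (η : Cone X) :
    Cone X where
  toMeasure := η.toMeasure.restrict {x | x ∈ Λ ∩ η.supp ∧ η.weight x ∈ Set.Icc a b}
  isDiscreteRadon := by
    obtain ⟨hfin, S, w, hS, -, hη⟩ := η.isDiscreteRadon
    refine isDiscreteRadon_of_countable
      (fun C hC => (Measure.restrict_apply_le _ _).trans_lt (hfin C hC)) hS ?_
    refine le_antisymm ((Measure.restrict_apply_le _ _).trans (le_of_eq ?_)) bot_le
    rw [hη, Measure.sum_apply _ hS.measurableSet.compl]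
    simp

/-- Finite local moments of all orders: `∫ η(Λ)^n dμ(η) < ∞`. -/
def HasFiniteLocalMoments (μ : Measure (Cone X)) : Prop :=
  ∀ (n : ℕ) (Λ : Set X), IsBoundedBorel Λ → ∫⁻ η, η.toMeasure Λ ^ n ∂μ < ∞

/-- `μ ∘ p_{Λ,a,b}⁻¹ ≪ π ∘ p_{Λ,a,b}⁻¹` for all bounded Borel `Λ` and `0 < a < b`. -/
def IsLocallyAbsolutelyContinuous [MeasurableSingletonClass X] (μ π : Measure (Cone X)) : Prop :=
  ∀ (Λ : Set X) (a b : ℝ), IsBoundedBorel Λ → 0 < a → a < b →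
    ∀ B : Set (Cone X), MeasurableSet B →
      π (Cone.proj Λ a b ⁻¹' B) = 0 → μ (Cone.proj Λ a b ⁻¹' B) = 0

/-! ### Configurations over `(0, ∞) × X` and the Poisson measure -/

variable (X) in
/-- The space `Γ` of locally finite configurations over `(0, ∞) × X`. -/
structure Config where
  carrier : Set (PosReal × X)
  locallyFinite : ∀ (Λ : Set X) (a b : ℝ), IsBoundedBorel Λ → 0 < a → a < b →
    (carrier ∩ weightIcc a b ×ˢ Λ).Finite

/-- The configuration as the measure `∑_{y ∈ γ} δ_y`. -/
noncomputable def Config.toMeasure (γ : Config X) : Measure (PosReal × X) :=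
  Measure.sum fun y : γ.carrier => Measure.dirac (y : PosReal × X)

/-- The vague topology on `Γ`. -/
noncomputable instance Config.instTopologicalSpace : TopologicalSpace (Config X) :=
  TopologicalSpace.induced
    (fun γ (f : CompactlySupportedContinuousMap (PosReal × X) ℝ) => ∫ y, f y ∂γ.toMeasure)
    inferInstance

noncomputable instance Config.instMeasurableSpace : MeasurableSpace (Config X) := borel (Config X)

/-- The number of points of `γ` in `B`. -/
noncomputable def Config.count (B : Set (PosReal × X)) (γ : Config X) : ℕ := (γ.carrier ∩ B).ncard

/-- `π` is the Poisson measure on `Γ` with intensity `m`: the number of points in a bounded Borel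
set `B` has the Poisson distribution with parameter `m B`, and the numbers of points in disjoint
bounded Borel sets are independent. -/
structure IsPoissonMeasure (m : Measure (PosReal × X)) (π : Measure (Config X)) : Prop where
  isProbabilityMeasure : IsProbabilityMeasure π
  law_count : ∀ B : Set (PosReal × X), IsBoundedBorel B →
    π.map (Config.count B) = ProbabilityTheory.poissonMeasure (m B).toNNReal
  indep_count : ∀ (n : ℕ) (B : Fin n → Set (PosReal × X)), (∀ i, IsBoundedBorel (B i)) →
    Pairwise (Function.onFun Disjoint B) →
    ProbabilityTheory.iIndepFun (fun i => Config.count (B i)) π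

/-- The local mass `γ(Λ) = ∑_{(s,x) ∈ γ} s 1_Λ(x)`. -/
noncomputable def Config.localMass (γ : Config X) (Λ : Set X) : ℝ≥0∞ :=
  ∑' y : γ.carrier, Λ.indicator (fun _ => ENNReal.ofReal (y.1.1 : ℝ)) y.1.2

/-- Membership in `Π`: pinpointing configurations (no two points over the same `x`) with finite
local mass. -/
def Config.IsPinpointing (γ : Config X) : Prop :=
  (∀ y ∈ γ.carrier, ∀ z ∈ γ.carrier, y.2 = z.2 → y.1 = z.1) ∧
    ∀ Λ : Set X, IsBoundedBorel Λ → γ.localMass Λ < ∞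

variable (X) in
/-- The space `Π`, with the trace `σ`-algebra of `Γ`. -/
abbrev PinConfig : Type _ := {γ : Config X // γ.IsPinpointing}

theorem Config.countable [PolishSpace X] [LocallyCompactSpace X] [BorelSpace X] (γ : Config X) :
    γ.carrier.Countable := by
  have h : γ.carrier ⊆ ⋃ n : ℕ,
      γ.carrier ∩ weightIcc (1 / ((n : ℝ) + 2)) ((n : ℝ) + 2) ×ˢ compactCovering X n := by
    intro y hy
    obtain ⟨k, hk⟩ := mem_iUnion.1
      ((iUnion_compactCovering X).symm ▸ mem_univ y.2 : y.2 ∈ ⋃ n, compactCovering X n)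
    obtain ⟨l, hl⟩ := exists_nat_gt (y.1 : ℝ)
    obtain ⟨j, hj⟩ := exists_nat_gt (1 / (y.1 : ℝ))
    have hpos : (0 : ℝ) < y.1 := y.1.2
    have hmk : (k : ℝ) ≤ ((k + l + j : ℕ) : ℝ) := by exact_mod_cast (by omega)
    have hml : (l : ℝ) ≤ ((k + l + j : ℕ) : ℝ) := by exact_mod_cast (by omega)
    have hmj : (j : ℝ) ≤ ((k + l + j : ℕ) : ℝ) := by exact_mod_cast (by omega)
    refine mem_iUnion.2 ⟨k + l + j, hy, ⟨?_, ?_⟩, ?_⟩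
    · rw [div_le_iff₀ (by positivity)]
      rw [div_lt_iff₀ hpos] at hj
      nlinarith
    · linarith
    · exact compactCovering_subset X (by omega) hk
  refine (countable_iUnion fun n => (γ.locallyFinite _ _ _ ?_ ?_ ?_).countable).mono h
  · exact ⟨(isCompact_compactCovering X n).measurableSet,
      (isCompact_compactCovering X n).closure⟩
  · positivity
  · have : (0 : ℝ) ≤ n := n.cast_nonneg
    rw [div_lt_iff₀ (by positivity)]
    nlinarith

/-- The bijection `R : Π → 𝕂(X)`, `∑ δ_{(s,x)} ↦ ∑ s δ_x`. -/
noncomputable def toCone [PolishSpace X] [LocallyCompactSpace X] [BorelSpace X] (γ : PinConfig X) :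
    Cone X where
  toMeasure := Measure.sum fun y : γ.1.carrier =>
    ENNReal.ofReal (y.1.1 : ℝ) • Measure.dirac y.1.2
  isDiscreteRadon := by
    have hc : (Prod.snd '' γ.1.carrier).Countable := γ.1.countable.image _
    refine isDiscreteRadon_of_countable (fun C hC => ?_) hc ?_
    · have h := γ.2.2 C ⟨hC.measurableSet, hC.closure⟩
      rw [Measure.sum_apply _ hC.measurableSet]
      refine lt_of_eq_of_lt (tsum_congr fun y => ?_) h
      rw [Measure.smul_apply, Measure.dirac_apply' _ hC.measurableSet]
      by_cases hy : y.1.2 ∈ C <;> simp [hy]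
    · rw [Measure.sum_apply _ hc.measurableSet.compl, ENNReal.tsum_eq_zero]
      intro y
      have hy : y.1.2 ∈ Prod.snd '' γ.1.carrier := mem_image_of_mem _ y.2
      rw [Measure.smul_apply, Measure.dirac_apply' _ hc.measurableSet.compl,
        indicator_of_notMem (Set.notMem_compl_iff.2 hy), smul_zero]

/-- For a measure `π` on `Γ` with `π(Π) = 1`: the push-forward under `R` of `π` viewed as a
measure on `Π`. For the Poisson measure `π` with intensity `ν ⊗ σ` this is `π_{𝕂,ν⊗σ}`. -/
noncomputable def coneMeasure [PolishSpace X] [LocallyCompactSpace X] [BorelSpace X]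
    (π : Measure (Config X)) : Measure (Cone X) :=
  (π.comap (Subtype.val : PinConfig X → Config X)).map toCone

/-! ### Finite configurations and the sub-cone of measures with finite support -/

variable (X) in
/-- The space `Γ₀` of finite configurations over `(0, ∞) × X`. -/
structure FinConfig where
  carrier : Set (PosReal × X)
  finite : carrier.Finite

/-- An `n`-tuple of distinct points, viewed as a finite configuration. -/
def FinConfig.ofTuple (y : Σ n : ℕ, {y : Fin n → PosReal × X // Function.Injective y}) :
    FinConfig X where
  carrier := Set.range y.2.1
  finite := Set.finite_range _

/-- The topology of `Γ₀ = ⨆ₙ Γ₀⁽ⁿ⁾`: the disjoint union of the quotients, by the permutations of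
coordinates, of the spaces of `n`-tuples of distinct points. -/
instance FinConfig.instTopologicalSpace : TopologicalSpace (FinConfig X) :=
  TopologicalSpace.coinduced FinConfig.ofTuple inferInstance

instance FinConfig.instMeasurableSpace : MeasurableSpace (FinConfig X) := borel (FinConfig X)

/-- A finite configuration is locally finite. -/
def FinConfig.toConfig (γ : FinConfig X) : Config X where
  carrier := γ.carrier
  locallyFinite _ _ _ _ _ _ := γ.finite.inter_of_left _

variable (X) in
/-- The space `Π₀` of finite pinpointing configurations, with the trace `σ`-algebra of `Γ₀`. -/
abbrev PinFinConfig : Type _ := {γ : FinConfig X // γ.toConfig.IsPinpointing}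

variable (X) in
/-- The sub-cone `𝕂₀(X)` of the measures with finite support. -/
structure FinCone where
  toCone : Cone X
  finite : toCone.supp.Finite

/-- The restriction `R : Π₀ → 𝕂₀(X)`. -/
noncomputable def toFinCone [PolishSpace X] [LocallyCompactSpace X] [BorelSpace X]
    (γ : PinFinConfig X) : FinCone X where
  toCone := DiscreteCone.toCone ⟨γ.1.toConfig, γ.2⟩
  finite := by
    refine (γ.1.finite.image Prod.snd).subset fun x hx => ?_
    by_contra hn
    refine ne_of_gt (Cone.mem_supp.1 hx) ?_
    change (Measure.sum fun y : γ.1.carrier =>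
      ENNReal.ofReal (y.1.1 : ℝ) • Measure.dirac y.1.2) {x} = 0
    rw [Measure.sum_apply _ (measurableSet_singleton x), ENNReal.tsum_eq_zero]
    intro y
    have hy : y.1.2 ≠ x := fun h => hn ⟨y.1, y.2, h⟩
    simp [hy]

/-- The `σ`-algebra `{R(A) : A ∈ 𝓑(Π₀)}` on `𝕂₀(X)`; as `R : Π₀ → 𝕂₀(X)` is bijective, a set belongs
to it if and only if its preimage under `R` belongs to `𝓑(Π₀)`. -/
noncomputable instance FinCone.instMeasurableSpace [PolishSpace X] [LocallyCompactSpace X]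
    [BorelSpace X] : MeasurableSpace (FinCone X) :=
  MeasurableSpace.map toFinCone inferInstance

/-- Boundedness of a set in `𝕂₀(X)`. -/
def IsBoundedFinCone (A : Set (FinCone X)) : Prop :=
  ∃ (Λ : Set X) (a b : ℝ) (N : ℕ), IsBoundedBorel Λ ∧ 0 < a ∧ a < b ∧
    ∀ ξ ∈ A, ξ.toCone.supp ⊆ Λ ∧ ξ.toCone.supp.ncard ≤ N ∧
      ∀ x ∈ ξ.toCone.supp, ξ.toCone.weight x ∈ Set.Icc a b

/-- The relation `ξ ⋐ η`: `ξ` has finite support, `τ(ξ) ⊆ τ(η)`, and the weights of `ξ` and `η` agree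
on `τ(ξ)`. -/
def FinCone.IsSub (ξ : FinCone X) (η : Cone X) : Prop :=
  ξ.toCone.supp ⊆ η.supp ∧ ∀ x ∈ ξ.toCone.supp, ξ.toCone.weight x = η.weight x

/-- The `K`-transform `(K G)(η) = ∑_{ξ ⋐ η} G(ξ)`. For `G` with local support (in particular for
indicators of bounded sets) only finitely many terms are non-zero. -/
noncomputable def kTransform (G : FinCone X → ℝ) (η : Cone X) : ℝ :=
  ∑' ξ : {ξ : FinCone X // ξ.IsSub η}, G ξ.1

/-- `ρ` is a correlation measure of `μ`: `ρ(A) = ∫ K 1_A dμ` for all bounded measurable `A`. -/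
def IsCorrelationMeasure [PolishSpace X] [LocallyCompactSpace X] [BorelSpace X]
    (μ : Measure (Cone X)) (ρ : Measure (FinCone X)) : Prop :=
  ∀ A : Set (FinCone X), MeasurableSet A → IsBoundedFinCone A →
    ρ A = ∫⁻ η, ENNReal.ofReal (kTransform (A.indicator fun _ => 1) η) ∂μ

/-- The measure `∑ᵢ sᵢ δ_{xᵢ}` for an `n`-tuple of pairs `(sᵢ, xᵢ)`. -/
noncomputable def tupleMeasure [PolishSpace X] [BorelSpace X] {n : ℕ} (y : Fin n → PosReal × X) :
    FinCone X where
  toCone :=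
    { toMeasure := ∑ i, ENNReal.ofReal ((y i).1 : ℝ) • Measure.dirac (y i).2
      isDiscreteRadon := by
        have hc : (Set.range fun i => (y i).2).Countable := (Set.finite_range _).countable
        refine isDiscreteRadon_of_countable (fun C _ => ?_) hc ?_
        · rw [Measure.finsetSum_apply]
          refine ENNReal.sum_lt_top.2 fun i _ => ?_
          exact ENNReal.mul_lt_top ENNReal.ofReal_lt_top (measure_lt_top _ _)
        · rw [Measure.finsetSum_apply]
          refine Finset.sum_eq_zero fun i _ => ?_
          simp [Measure.dirac_apply' _ hc.measurableSet.compl] }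
  finite := by
    refine (Set.finite_range fun i => (y i).2).subset fun x hx => ?_
    by_contra hn
    refine ne_of_gt (Cone.mem_supp.1 hx) ?_
    change (∑ i, ENNReal.ofReal ((y i).1 : ℝ) • Measure.dirac (y i).2 : Measure X) {x} = 0
    rw [Measure.finsetSum_apply]
    refine Finset.sum_eq_zero fun i _ => ?_
    have hy : (y i).2 ≠ x := fun h => hn ⟨i, h⟩
    simp [hy]

variable (X) in
/-- The `n`-tuples of pairs `(sᵢ, xᵢ)` with pairwise distinct `xᵢ`. -/
abbrev DistinctTuple (n : ℕ) : Type _ :=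
  {y : Fin n → PosReal × X // Function.Injective fun i => (y i).2}

/-- The Lebesgue–Poisson measure on `𝕂₀(X)` with intensity `m = ν ⊗ σ`,
`∫ G dλ = ∑ₙ (1/n!) ∫ G(∑ᵢ sᵢ δ_{xᵢ}) dm^{⊗n}`; the term `n = 0` is `G(0)`. The tuples with two
coinciding `xᵢ`, which form an `m^{⊗n}`-null set for non-atomic `σ`, are left out. -/
noncomputable def lebesguePoisson [PolishSpace X] [LocallyCompactSpace X] [BorelSpace X]
    (m : Measure (PosReal × X)) : Measure (FinCone X) :=
  Measure.sum fun n : ℕ => ((n.factorial : ℝ≥0∞)⁻¹) •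
    ((Measure.pi fun _ : Fin n => m).comap (Subtype.val : DistinctTuple X n → _)).map
      fun y => tupleMeasure y.1

end Definitions

end DiscreteCone

/-! A discrete Radon measure `η` is encoded by its set of points `(s_x, x)`, and `ξ ⋐ η` becomes
inclusion of point sets (`FinCone.isSub_iff`). Hence `∑_{ξ ⋐ η} δ_ξ` is a measure `subKernel η` on
the finite cone, and the correlation measure is its average over `μ`, `μ.bind subKernel`. It is the
only one, because the finite cone is an increasing union of bounded measurable sets (`exhaustion`).

Averaging needs `η ↦ subKernel η A` to be measurable (`measurable_subKernel`). For `A` inside one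
set of the exhaustion, only the finitely many points of `η` in a compact box matter, and the sum
over finite subsets is a sum over `n`-tuples of points divided by `n!` (`subKernel_eq_tsum`). On
rectangles the tuple sum factors into counts of points (`Cone.tupleSum_pi`), and such a count is an
integral against `η` of a function involving the atom masses `η {x}`
(`Cone.measurable_tsum_points`).

Absolute continuity rests on one fact about Poisson measures: almost surely, no tuple of distinct
points of the configuration lies in a given null set of the product of the intensity
(`IsPoissonMeasure.measure_exists_tuple_eq_zero`). If `A` is null for the Lebesgue–Poisson measure,
the sets of tuples representing `A` are null, so under the Poisson law almost no `η` has some `ξ ⋐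
η` in `A`. For `A` in the exhaustion this event depends on `η` only through a projection
`p_{Λ,a,b}`, so local absolute continuity carries the null event over to `μ`.

Finally, the number of points of `η` in a box is at most a constant times the mass of a compact set,
so the moment bounds make the correlation measure finite on the exhaustion. Both measures are then
σ-finite, and Radon–Nikodym gives a density. -/

set_option linter.unusedSectionVars false

namespace DiscreteCone

/-! ### Discrete Radon measures and their sets of points -/

section ConeBasics

variable {X : Type*} [TopologicalSpace X] [MeasurableSpace X]

theorem Cone.measure_singleton_lt_top (η : Cone X) (x : X) : η.toMeasure {x} < ∞ :=
  η.isDiscreteRadon.1 _ isCompact_singleton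

theorem Cone.ofReal_weight (η : Cone X) (x : X) :
    ENNReal.ofReal (η.weight x) = η.toMeasure {x} :=
  ENNReal.ofReal_toReal (η.measure_singleton_lt_top x).ne

theorem Cone.mem_supp_iff_weight_pos {η : Cone X} {x : X} : x ∈ η.supp ↔ 0 < η.weight x := by
  rw [Cone.mem_supp, ← η.ofReal_weight, ENNReal.ofReal_pos]

theorem Cone.ext_toMeasure {η ζ : Cone X} (h : η.toMeasure = ζ.toMeasure) : η = ζ := by
  cases η; cases ζ; cases h; rfl

theorem FinCone.ext_toCone {ξ ζ : FinCone X} (h : ξ.toCone = ζ.toCone) : ξ = ζ := by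
  cases ξ; cases ζ; cases h; rfl

/-- The index set and weights in the definition are only existential; evaluating on singletons
forces them to be the support and the atom masses. -/
theorem Cone.exists_countable_sum [MeasurableSingletonClass X] (η : Cone X) :
    η.supp.Countable ∧
      η.toMeasure = Measure.sum fun x : η.supp => η.toMeasure {(x : X)} • Measure.dirac (x : X) := by
  obtain ⟨-, S, w, hS, hw, hη⟩ := η.isDiscreteRadon
  have hval : ∀ x, η.toMeasure {x} = S.indicator (fun x => ENNReal.ofReal (w x)) x := by
    intro x
    rw [hη, Measure.sum_apply _ (measurableSet_singleton x)]
    by_cases hx : x ∈ S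
    · rw [tsum_eq_single (⟨x, hx⟩ : S)]
      · simp [hx]
      · intro y hy
        have : (y : X) ≠ x := fun h => hy (Subtype.ext h)
        simp [this]
    · rw [indicator_of_notMem hx, ENNReal.tsum_eq_zero]
      intro y
      have : (y : X) ≠ x := fun h => hx (h ▸ y.2)
      simp [this]
  have hsupp : η.supp = S := by
    ext x
    rw [Cone.mem_supp, hval]
    by_cases hx : x ∈ S
    · simp [hx, hw x hx]
    · simp [hx]
  refine ⟨hsupp ▸ hS, ?_⟩
  rw [hsupp]
  conv_lhs => rw [hη]
  congr 1
  funext x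
  rw [hval, indicator_of_mem x.2]

theorem Cone.lintegral_eq_tsum [MeasurableSingletonClass X] (η : Cone X) {f : X → ℝ≥0∞} (hf : Measurable f) :
    ∫⁻ x, f x ∂η.toMeasure = ∑' x : η.supp, η.toMeasure {(x : X)} * f x := by
  conv_lhs => rw [η.exists_countable_sum.2]
  rw [lintegral_sum_measure]
  refine tsum_congr fun x => ?_
  rw [lintegral_smul_measure, lintegral_dirac' _ hf, smul_eq_mul]

/-- The points `(s_x, x)`, `x ∈ τ(η)`. -/
def Cone.points (η : Cone X) : Set (PosReal × X) := {y | η.weight y.2 = y.1}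

theorem Cone.mem_supp_of_mem_points {η : Cone X} {y : PosReal × X} (hy : y ∈ η.points) :
    y.2 ∈ η.supp := by
  have h : η.weight y.2 = y.1 := hy
  rw [Cone.mem_supp_iff_weight_pos, h]
  exact y.1.2

theorem Cone.snd_injOn_points (η : Cone X) : InjOn Prod.snd η.points := by
  intro y hy z hz h
  have h1 : η.weight y.2 = y.1 := hy
  have h2 : η.weight z.2 = z.1 := hz
  refine Prod.ext (Subtype.ext ?_) h
  rw [← h1, ← h2, h]

/-- The point of `η` over an element of its support. -/
noncomputable def Cone.point (η : Cone X) (x : η.supp) : PosReal × X :=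
  (⟨η.weight x, Cone.mem_supp_iff_weight_pos.1 x.2⟩, x)

theorem Cone.point_mem (η : Cone X) (x : η.supp) : η.point x ∈ η.points := rfl

theorem Cone.snd_image_points (η : Cone X) : Prod.snd '' η.points = η.supp := by
  ext x
  constructor
  · rintro ⟨y, hy, rfl⟩
    exact Cone.mem_supp_of_mem_points hy
  · intro hx
    exact ⟨η.point ⟨x, hx⟩, rfl, rfl⟩

/-- The support and the points of `η` are in bijection. -/
noncomputable def Cone.suppEquivPoints (η : Cone X) : η.supp ≃ η.points where
  toFun x := ⟨η.point x, rfl⟩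
  invFun y := ⟨y.1.2, Cone.mem_supp_of_mem_points y.2⟩
  left_inv _ := rfl
  right_inv y := Subtype.ext (η.snd_injOn_points rfl y.2 rfl)

theorem Cone.points_subset_iff {ξ η : Cone X} :
    ξ.points ⊆ η.points ↔ ξ.supp ⊆ η.supp ∧ ∀ x ∈ ξ.supp, ξ.weight x = η.weight x := by
  constructor
  · intro h
    refine ⟨?_, fun x hx => ?_⟩
    · rw [← ξ.snd_image_points, ← η.snd_image_points]
      exact image_mono h
    · exact (h (ξ.point_mem ⟨x, hx⟩) : η.weight x = ξ.weight x).symm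
  · rintro ⟨-, h⟩ y hy
    have h1 : ξ.weight y.2 = y.1 := hy
    exact (h _ (Cone.mem_supp_of_mem_points hy)).symm.trans h1

/-- Equality of point sets gives the same support and the same atoms, and integrals against a
discrete measure are sums over its atoms. -/
theorem Cone.points_injective [MeasurableSingletonClass X] : Function.Injective (Cone.points : Cone X → _) := by
  intro ξ η h
  obtain ⟨h1, h2⟩ := Cone.points_subset_iff.1 h.subset
  obtain ⟨h3, -⟩ := Cone.points_subset_iff.1 h.symm.subset
  refine Cone.ext_toMeasure ?_
  have hw : ∀ x ∈ ξ.supp, ξ.toMeasure {x} = η.toMeasure {x} := fun x hx => by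
    rw [← ξ.ofReal_weight, ← η.ofReal_weight, h2 x hx]
  have hs : ξ.supp = η.supp := h1.antisymm h3
  refine Measure.ext_of_lintegral _ fun f hf => ?_
  rw [ξ.lintegral_eq_tsum hf, η.lintegral_eq_tsum hf, ← hs]
  exact tsum_congr fun x => by rw [hw x x.2]

theorem FinCone.isSub_iff {ξ : FinCone X} {η : Cone X} :
    ξ.IsSub η ↔ ξ.toCone.points ⊆ η.points :=
  Cone.points_subset_iff.symm

theorem FinCone.finite_points (ξ : FinCone X) : ξ.toCone.points.Finite :=
  Finite.of_finite_image (by rw [Cone.snd_image_points]; exact ξ.finite) ξ.toCone.snd_injOn_points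

/-- The points of a measure with finite support, as a `Finset`. -/
noncomputable def FinCone.pts (ξ : FinCone X) : Finset (PosReal × X) := ξ.finite_points.toFinset

theorem FinCone.coe_pts (ξ : FinCone X) : (ξ.pts : Set (PosReal × X)) = ξ.toCone.points :=
  ξ.finite_points.coe_toFinset

theorem FinCone.pts_injective [MeasurableSingletonClass X] : Function.Injective (FinCone.pts : FinCone X → _) := by
  intro ξ ζ h
  refine FinCone.ext_toCone (Cone.points_injective ?_)
  rw [← ξ.coe_pts, ← ζ.coe_pts, h]

/-- In a set of finite mass, there are finitely many points with weight bounded below. -/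
theorem Cone.card_mul_le [MeasurableSingletonClass X] (η : Cone X) {a : ℝ} {Λ : Set X} {t : Finset (PosReal × X)}
    (ht : ↑t ⊆ η.points) (h : ∀ y ∈ t, a ≤ (y.1 : ℝ) ∧ y.2 ∈ Λ) :
    (t.card : ℝ≥0∞) * ENNReal.ofReal a ≤ η.toMeasure Λ := by
  classical
  have hinj : InjOn Prod.snd (t : Set (PosReal × X)) := η.snd_injOn_points.mono ht
  calc (t.card : ℝ≥0∞) * ENNReal.ofReal a = ∑ y ∈ t, ENNReal.ofReal a := by simp
    _ ≤ ∑ y ∈ t, η.toMeasure {y.2} := by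
        refine Finset.sum_le_sum fun y hy => ?_
        rw [← η.ofReal_weight]
        have h1 : η.weight y.2 = y.1 := ht hy
        rw [h1]
        exact ENNReal.ofReal_le_ofReal (h y hy).1
    _ = ∑ x ∈ t.image Prod.snd, η.toMeasure {x} := by
        rw [Finset.sum_image hinj]
    _ = η.toMeasure (t.image Prod.snd : Finset X) := sum_measure_singleton
    _ ≤ η.toMeasure Λ := by
        refine measure_mono fun x hx => ?_
        obtain ⟨y, hy, rfl⟩ := Finset.mem_image.1 (Finset.mem_coe.1 hx)
        exact (h y hy).2

theorem Cone.finite_points_inter [MeasurableSingletonClass X] (η : Cone X) {a b : ℝ} (ha : 0 < a) {Λ : Set X}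
    (hΛ : η.toMeasure Λ < ∞) : (η.points ∩ weightIcc a b ×ˢ Λ).Finite := by
  by_contra hinf
  have ha' : ENNReal.ofReal a ≠ 0 := by simpa using ha
  obtain ⟨n, hn⟩ := ENNReal.exists_nat_gt (ENNReal.div_lt_top hΛ.ne ha').ne
  obtain ⟨t, ht, hcard⟩ := Set.Infinite.exists_subset_card_eq hinf n
  have := η.card_mul_le (a := a) (Λ := Λ) (t := t) (fun y hy => (ht hy).1)
    (fun y hy => ⟨(ht hy).2.1.1, (ht hy).2.2⟩)
  rw [hcard] at this
  rw [ENNReal.div_lt_iff (Or.inl ha') (Or.inl ENNReal.ofReal_ne_top)] at hn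
  exact absurd this hn.not_ge

instance Cone.instBorelSpace : BorelSpace (Cone X) := ⟨rfl⟩

theorem Cone.isFiniteMeasureOnCompacts (η : Cone X) : IsFiniteMeasureOnCompacts η.toMeasure :=
  ⟨fun {_} hK => η.isDiscreteRadon.1 _ hK⟩

theorem Cone.measurable_integral (f : CompactlySupportedContinuousMap X ℝ) :
    Measurable fun η : Cone X => ∫ x, f x ∂η.toMeasure := by
  have h : Continuous fun η : Cone X =>
      fun g : CompactlySupportedContinuousMap X ℝ => ∫ x, g x ∂η.toMeasure :=
    continuous_induced_dom
  exact ((continuous_apply f).comp h).measurable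

end ConeBasics

/-! ### Measurability with respect to the vague topology -/

section Measurability

variable {X : Type*} [TopologicalSpace X] [PolishSpace X] [LocallyCompactSpace X]
  [MeasurableSpace X] [BorelSpace X]

/-- The indicator of `K` is a pointwise limit of continuous thickened indicators. Their supports lie
in one compact thickening, so their integrals are vaguely continuous and converge. -/
theorem Cone.measurable_apply_of_isCompact {K : Set X} (hK : IsCompact K) :
    Measurable fun η : Cone X => η.toMeasure K := by
  let := TopologicalSpace.upgradeIsCompletelyMetrizable X
  obtain ⟨δ, δpos, hδ⟩ := hK.exists_isCompact_cthickening
  set K' := Metric.cthickening δ K with hK'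
  have hpos : ∀ n : ℕ, 0 < δ / (n + 1) := fun n => by positivity
  have hlim : Filter.Tendsto (fun n : ℕ => δ / (n + 1)) Filter.atTop (nhds 0) :=
    tendsto_const_div_atTop_nhds_zero_nat δ |>.comp (Filter.tendsto_add_atTop_nat 1) |>.congr
      (fun n => by simp)
  have hzero : ∀ n x, x ∉ K' → thickenedIndicator (hpos n) K x = 0 := by
    intro n x hx
    refine thickenedIndicator_zero (hpos n) K fun h => hx ?_
    refine Metric.thickening_subset_cthickening _ _ (Metric.thickening_mono ?_ _ h)
    exact div_le_self δpos.le (by simp)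
  let f : ℕ → CompactlySupportedContinuousMap X ℝ := fun n =>
    { toFun := fun x => (thickenedIndicator (hpos n) K x : ℝ)
      continuous_toFun := NNReal.continuous_coe.comp (thickenedIndicator (hpos n) K).continuous
      hasCompactSupport' := HasCompactSupport.intro hδ fun x hx => by simp [hzero n x hx] }
  refine measurable_of_tendsto_metrizable' Filter.atTop
    (f := fun (n : ℕ) (η : Cone X) => ENNReal.ofReal (∫ x, f n x ∂η.toMeasure))
    (fun n => (Cone.measurable_integral (f n)).ennreal_ofReal) ?_
  rw [tendsto_pi_nhds]
  intro η
  have := η.isFiniteMeasureOnCompacts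
  -- `η` may be infinite, while the convergence theorem wants a finite measure; restricting to `K'`
  -- changes none of the integrals.
  have : IsFiniteMeasure (η.toMeasure.restrict K') :=
    ⟨by rw [Measure.restrict_apply_univ]; exact η.isDiscreteRadon.1 _ hδ⟩
  have h := tendsto_lintegral_thickenedIndicator_of_isClosed (η.toMeasure.restrict K')
    hK.isClosed hpos hlim
  rw [Measure.restrict_apply hK.measurableSet,
    inter_eq_self_of_subset_left (Metric.self_subset_cthickening K)] at h
  refine h.congr fun n => ?_
  rw [ofReal_integral_eq_lintegral_ofReal]
  · rw [← lintegral_indicator hδ.measurableSet]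
    refine lintegral_congr fun x => ?_
    by_cases hx : x ∈ K'
    · rw [indicator_of_mem hx]
      exact (ENNReal.ofReal_coe_nnreal).symm
    · rw [indicator_of_notMem hx]
      change 0 = ENNReal.ofReal ((thickenedIndicator (hpos n) K x : ℝ≥0) : ℝ)
      simp [hzero n x hx]
  · exact (f n).continuous.integrable_of_hasCompactSupport (f n).hasCompactSupport
  · exact Filter.Eventually.of_forall fun x => NNReal.coe_nonneg _

theorem Cone.measurable_restrict_of_isCompact {K : Set X} (hK : IsCompact K) :
    Measurable fun η : Cone X => η.toMeasure.restrict K := by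
  have : ∀ η : Cone X, IsFiniteMeasure (η.toMeasure.restrict K) := fun η =>
    ⟨by rw [Measure.restrict_apply_univ]; exact η.isDiscreteRadon.1 _ hK⟩
  refine Measurable.measure_of_isPiSystem (S := {s | IsClosed s})
    (by rw [BorelSpace.measurable_eq (α := X), borel_eq_generateFrom_isClosed])
    isPiSystem_isClosed ?_ ?_
  · intro s hs
    simp_rw [Measure.restrict_apply (IsClosed.measurableSet hs)]
    exact Cone.measurable_apply_of_isCompact (hK.inter_left hs)
  · simp_rw [Measure.restrict_apply_univ]
    exact Cone.measurable_apply_of_isCompact hK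

theorem Cone.lintegral_eq_iSup {X : Type*} [TopologicalSpace X] [PolishSpace X]
    [LocallyCompactSpace X] [MeasurableSpace X] (η : Cone X) (f : X → ℝ≥0∞) :
    ∫⁻ x, f x ∂η.toMeasure = ⨆ j, ∫⁻ x in compactCovering X j, f x ∂η.toMeasure := by
  rw [← setLIntegral_iUnion_of_directed f
    (Monotone.directed_le fun i j h => compactCovering_subset X h), iUnion_compactCovering,
    setLIntegral_univ]

theorem Cone.measurable_toMeasure : Measurable (Cone.toMeasure : Cone X → Measure X) := by
  refine Measure.measurable_of_measurable_coe _ fun s hs => ?_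
  have : (fun η : Cone X => η.toMeasure s) =
      fun η => ⨆ j, (η.toMeasure.restrict (compactCovering X j)) s := by
    funext η
    have h := η.lintegral_eq_iSup (s.indicator 1)
    simpa only [lintegral_indicator_one hs] using h
  rw [this]
  exact Measurable.iSup fun j => (Measure.measurable_coe hs).comp
    (Cone.measurable_restrict_of_isCompact (isCompact_compactCovering X j))

theorem Cone.measurable_apply {s : Set X} (hs : MeasurableSet s) :
    Measurable fun η : Cone X => η.toMeasure s :=
  (Measure.measurable_coe hs).comp Cone.measurable_toMeasure

/-- The mass of points depends measurably on the measure and the point. -/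
theorem Cone.measurable_apply_singleton :
    Measurable fun p : Cone X × X => p.1.toMeasure {p.2} := by
  classical
  have hb := TopologicalSpace.isBasis_countableBasis X
  have hc := TopologicalSpace.countable_countableBasis X
  have := hc.to_subtype
  -- Outer regularity, with open sets taken from a countable basis, turns the mass of a point into a
  -- countable infimum of jointly measurable functions.
  have key : (fun p : Cone X × X => p.1.toMeasure {p.2}) = fun p =>
      ⨅ U : TopologicalSpace.countableBasis X,
        if p.2 ∈ (U : Set X) then p.1.toMeasure U else ∞ := by
    funext p
    have := p.1.isFiniteMeasureOnCompacts
    refine le_antisymm (le_iInf fun U => ?_) ?_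
    · split_ifs with h
      · exact measure_mono (singleton_subset_iff.2 h)
      · exact le_top
    · refine le_of_forall_gt fun r hr => ?_
      obtain ⟨V, hV, hVo, hVr⟩ := Set.exists_isOpen_lt_of_lt _ _ hr
      obtain ⟨U, hU, hxU, hUV⟩ := hb.exists_subset_of_mem_open (singleton_subset_iff.1 hV) hVo
      refine (iInf_le _ (⟨U, hU⟩ : TopologicalSpace.countableBasis X)).trans_lt ?_
      rw [if_pos hxU]
      exact (measure_mono hUV).trans_lt hVr
  rw [key]
  refine Measurable.iInf fun U => ?_
  have hU : MeasurableSet (U : Set X) := (hb.isOpen U.2).measurableSet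
  exact Measurable.ite (measurable_snd hU) ((Cone.measurable_apply hU).comp measurable_fst)
    measurable_const

theorem Cone.measurable_lintegral {f : Cone X × X → ℝ≥0∞} (hf : Measurable f) :
    Measurable fun η : Cone X => ∫⁻ x, f (η, x) ∂η.toMeasure := by
  simp_rw [Cone.lintegral_eq_iSup]
  refine Measurable.iSup fun j => ?_
  have hj := Cone.measurable_apply_of_isCompact (isCompact_compactCovering X j)
  have hfin : ∀ η : Cone X, η.toMeasure (compactCovering X j) + 1 ≠ ∞ := fun η =>
    ENNReal.add_ne_top.2 ⟨(η.isDiscreteRadon.1 _ (isCompact_compactCovering X j)).ne,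
      ENNReal.one_ne_top⟩
  -- Dividing by the mass plus one bounds the total mass uniformly by 1, so this is a finite kernel;
  -- the added one avoids division by zero. The factor is restored afterwards.
  let κ : ProbabilityTheory.Kernel (Cone X) X :=
    { toFun := fun η => (η.toMeasure (compactCovering X j) + 1)⁻¹ •
        η.toMeasure.restrict (compactCovering X j)
      measurable' := by
        refine Measure.measurable_of_measurable_coe _ fun s hs => ?_
        simp only [Measure.smul_apply, smul_eq_mul]
        exact (hj.add_const 1).inv.mul ((Measure.measurable_coe hs).comp
          (Cone.measurable_restrict_of_isCompact (isCompact_compactCovering X j))) }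
  have hκ : ∀ η, κ η = (η.toMeasure (compactCovering X j) + 1)⁻¹ •
        η.toMeasure.restrict (compactCovering X j) := fun η => rfl
  have : ProbabilityTheory.IsFiniteKernel κ := by
    refine ⟨1, ENNReal.one_lt_top, fun η => ?_⟩
    rw [hκ, Measure.smul_apply, Measure.restrict_apply_univ, smul_eq_mul, mul_comm,
      ← div_eq_mul_inv]
    exact ENNReal.div_le_of_le_mul (by rw [one_mul]; exact le_self_add)
  have h : Measurable fun η : Cone X => (η.toMeasure (compactCovering X j) + 1) *
      ∫⁻ x, f (η, x) ∂(κ η) :=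
    (hj.add_const 1).mul (Measurable.lintegral_kernel_prod_right' (κ := κ) hf)
  convert h using 2 with η
  rw [hκ, lintegral_smul_measure, smul_eq_mul, ← mul_assoc,
    ENNReal.mul_inv_cancel (by simp) (hfin η), one_mul]

/-- The number of points of a discrete Radon measure in a measurable set is measurable. -/
theorem Cone.measurable_tsum_points {E : Set (PosReal × X)} (hE : MeasurableSet E) :
    Measurable fun η : Cone X => ∑' y : η.points, E.indicator (fun _ => (1 : ℝ≥0∞)) y.1 := by
  -- The weight is zero off the support, so it is not a `PosReal` there; moving `E` into `ℝ × X`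
  -- lets the weight be substituted at every `x`.
  let e : PosReal × X → ℝ × X := Prod.map Subtype.val id
  have he : MeasurableEmbedding e :=
    (MeasurableEmbedding.subtype_coe measurableSet_Ioi).prodMap MeasurableEmbedding.id
  let g : ℝ × X → ℝ≥0∞ := (e '' E).indicator fun _ => 1
  have hg : Measurable g := measurable_const.indicator (he.measurableSet_image.2 hE)
  have hge : ∀ y, g (e y) = E.indicator (fun _ => (1 : ℝ≥0∞)) y := by
    intro y
    by_cases h : y ∈ E
    · simp only [g, indicator_of_mem h, indicator_of_mem (mem_image_of_mem e h)]
    · have h' : e y ∉ e '' E := fun h1 => h (he.injective.mem_set_image.1 h1)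
      simp only [g, indicator_of_notMem h, indicator_of_notMem h']
  clear_value g
  have hw : Measurable fun p : Cone X × X => (p.1.weight p.2, p.2) :=
    Cone.measurable_apply_singleton.ennreal_toReal.prodMk measurable_snd
  have hf : Measurable fun p : Cone X × X =>
      g (p.1.weight p.2, p.2) * (p.1.toMeasure {p.2})⁻¹ :=
    (hg.comp hw).mul Cone.measurable_apply_singleton.inv
  -- Integration against `η` weights each atom by its mass; the factor `(η {x})⁻¹` cancels this and
  -- leaves a count.
  have key : ∀ η : Cone X, ∑' y : η.points, E.indicator (fun _ => (1 : ℝ≥0∞)) y.1 =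
      ∫⁻ x, g (η.weight x, x) * (η.toMeasure {x})⁻¹ ∂η.toMeasure := by
    intro η
    have hη : Measurable fun x => g (η.weight x, x) * (η.toMeasure {x})⁻¹ :=
      hf.comp measurable_prodMk_left
    rw [η.lintegral_eq_tsum hη, ← η.suppEquivPoints.tsum_eq]
    refine tsum_congr fun x => ?_
    have hx : η.toMeasure {(x : X)} ≠ 0 := (Cone.mem_supp.1 x.2).ne'
    rw [mul_comm, mul_assoc, ENNReal.inv_mul_cancel hx (η.measure_singleton_lt_top _).ne, mul_one]
    exact (hge (η.point x)).symm
  rw [funext key]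
  exact Cone.measurable_lintegral hf

end Measurability

/-! ### Tuples of points and finite configurations -/

section Points

variable {X : Type*} [TopologicalSpace X] [PolishSpace X] [MeasurableSpace X] [BorelSpace X]

theorem tupleMeasure_apply_singleton {n : ℕ} (y : Fin n → PosReal × X) (x : X) :
    (tupleMeasure y).toCone.toMeasure {x} =
      ∑ i, ENNReal.ofReal ((y i).1 : ℝ) * ({(y i).2} : Set X).indicator (fun _ => 1) x := by
  classical
  change (∑ i, ENNReal.ofReal ((y i).1 : ℝ) • Measure.dirac (y i).2 : Measure X) {x} = _
  rw [Measure.finsetSum_apply]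
  refine Finset.sum_congr rfl fun i _ => ?_
  rw [Measure.smul_apply, Measure.dirac_apply' _ (measurableSet_singleton x), smul_eq_mul]
  simp only [indicator_apply, mem_singleton_iff, eq_comm, Pi.one_apply]

theorem points_tupleMeasure {n : ℕ} {y : Fin n → PosReal × X}
    (hy : Function.Injective fun i => (y i).2) :
    (tupleMeasure y).toCone.points = range y := by
  have hval : ∀ j, (tupleMeasure y).toCone.weight (y j).2 = (y j).1 := by
    intro j
    rw [Cone.weight, Measure.real_def, tupleMeasure_apply_singleton, Finset.sum_eq_single j]
    · simpa using le_of_lt (mem_Ioi.1 (y j).1.2)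
    · intro i _ hij
      have : (y j).2 ≠ (y i).2 := fun h => hij (hy h.symm)
      simp [this]
    · simp
  ext z
  constructor
  · intro hz
    have hs := Cone.mem_supp_of_mem_points hz
    by_contra hn
    have hz' : (tupleMeasure y).toCone.weight z.2 = z.1 := hz
    by_cases h : ∃ i, (y i).2 = z.2
    · obtain ⟨i, hi⟩ := h
      refine hn ⟨i, Prod.ext (Subtype.ext ?_) hi⟩
      rw [← hval, hi, hz']
    · push Not at h
      rw [Cone.mem_supp, tupleMeasure_apply_singleton] at hs
      refine hs.ne' (Finset.sum_eq_zero fun i _ => ?_)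
      simp [(h i).symm]
  · rintro ⟨i, rfl⟩
    exact hval i

theorem exists_tuple_range_eq {η : Cone X} {t : Finset (PosReal × X)} (ht : ↑t ⊆ η.points) :
    ∃ y : Fin t.card → PosReal × X, (Function.Injective fun i => (y i).2) ∧ range y = t := by
  refine ⟨fun i => t.equivFin.symm i, fun i j h => ?_, ?_⟩
  · have := η.snd_injOn_points (ht (t.equivFin.symm i).2) (ht (t.equivFin.symm j).2) h
    exact t.equivFin.symm.injective (Subtype.ext this)
  · change range (Subtype.val ∘ t.equivFin.symm) = _
    rw [range_comp, t.equivFin.symm.surjective.range_eq, image_univ]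
    exact Subtype.range_coe

theorem exists_pts_eq {η : Cone X} {t : Finset (PosReal × X)} (ht : ↑t ⊆ η.points) :
    ∃ ξ : FinCone X, ξ.pts = t := by
  obtain ⟨y, hy, hyt⟩ := exists_tuple_range_eq ht
  refine ⟨tupleMeasure y, Finset.coe_injective ?_⟩
  rw [FinCone.coe_pts, points_tupleMeasure hy, hyt]

theorem exists_tupleMeasure_eq (ξ : FinCone X) :
    ∃ (n : ℕ) (y : Fin n → PosReal × X),
      (Function.Injective fun i => (y i).2) ∧ tupleMeasure y = ξ := by
  obtain ⟨y, hy, hyt⟩ := exists_tuple_range_eq (η := ξ.toCone) (t := ξ.pts) ξ.coe_pts.subset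
  refine ⟨_, y, hy, FinCone.ext_toCone (Cone.points_injective ?_)⟩
  rw [points_tupleMeasure hy, hyt, FinCone.coe_pts]

variable [LocallyCompactSpace X]

theorem points_toCone (γ : PinConfig X) : (toCone γ).points = γ.1.carrier := by
  classical
  have hmass : ∀ x, (toCone γ).toMeasure {x} = ∑' y : γ.1.carrier,
      ENNReal.ofReal (y.1.1 : ℝ) * ({y.1.2} : Set X).indicator (fun _ => 1) x := by
    intro x
    change (Measure.sum fun y : γ.1.carrier =>
      ENNReal.ofReal (y.1.1 : ℝ) • Measure.dirac y.1.2) {x} = _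
    rw [Measure.sum_apply _ (measurableSet_singleton x)]
    refine tsum_congr fun y => ?_
    rw [Measure.smul_apply, Measure.dirac_apply' _ (measurableSet_singleton x), smul_eq_mul]
    simp only [indicator_apply, mem_singleton_iff, eq_comm, Pi.one_apply]
  have hval : ∀ y ∈ γ.1.carrier, (toCone γ).weight y.2 = y.1 := by
    intro y hy
    rw [Cone.weight, Measure.real_def, hmass, tsum_eq_single ⟨y, hy⟩]
    · simpa using le_of_lt (mem_Ioi.1 y.1.2)
    · rintro z hz
      have : y.2 ≠ z.1.2 := fun h =>
        hz (Subtype.ext (Prod.ext (γ.2.1 y hy z z.2 h).symm h.symm))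
      simp [this]
  ext z
  constructor
  · intro hz
    have hs := Cone.mem_supp_of_mem_points hz
    by_contra hn
    have hz' : (toCone γ).weight z.2 = z.1 := hz
    by_cases h : ∃ y ∈ γ.1.carrier, y.2 = z.2
    · obtain ⟨y, hy, hyz⟩ := h
      refine hn ?_
      have : y = z := Prod.ext (Subtype.ext (by rw [← hval y hy, hyz, hz'])) hyz
      exact this ▸ hy
    · push Not at h
      rw [Cone.mem_supp, hmass] at hs
      refine hs.ne' (ENNReal.tsum_eq_zero.2 fun y => ?_)
      simp [(h y y.2).symm]
  · exact hval z

theorem points_toFinCone (γ : PinFinConfig X) : (toFinCone γ).toCone.points = γ.1.carrier :=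
  points_toCone _

theorem isPinpointing_of_snd_injOn {γ : FinConfig X}
    (h : InjOn Prod.snd γ.carrier) : γ.toConfig.IsPinpointing := by
  refine ⟨fun y hy z hz hyz => congrArg Prod.fst (h hy hz hyz), fun Λ _ => ?_⟩
  have : Fintype γ.toConfig.carrier := γ.finite.fintype
  rw [Config.localMass, tsum_fintype]
  refine ENNReal.sum_lt_top.2 fun y _ => ?_
  exact (indicator_le_self _ _ _).trans_lt ENNReal.ofReal_lt_top

instance FinConfig.instBorelSpace : BorelSpace (FinConfig X) := ⟨rfl⟩

theorem DistinctTuple.injective {n : ℕ} (y : DistinctTuple X n) : Function.Injective y.1 :=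
  fun _ _ h => y.2 (congrArg Prod.snd h)

/-- A tuple with distinct second components as a pinpointing configuration. -/
def DistinctTuple.toPinFinConfig {n : ℕ} (y : DistinctTuple X n) : PinFinConfig X :=
  ⟨FinConfig.ofTuple ⟨n, y.1, y.injective⟩, isPinpointing_of_snd_injOn (by
    rintro _ ⟨i, rfl⟩ _ ⟨j, rfl⟩ h
    exact congrArg y.1 (y.2 h))⟩

theorem DistinctTuple.toFinCone_toPinFinConfig {n : ℕ} (y : DistinctTuple X n) :
    toFinCone y.toPinFinConfig = tupleMeasure y.1 := by
  refine FinCone.ext_toCone (Cone.points_injective ?_)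
  rw [points_toFinCone, points_tupleMeasure y.2]
  rfl

theorem DistinctTuple.measurable_toPinFinConfig (n : ℕ) :
    Measurable (DistinctTuple.toPinFinConfig : DistinctTuple X n → PinFinConfig X) := by
  refine Measurable.subtype_mk ?_
  have h1 : Continuous (FinConfig.ofTuple (X := X)) := continuous_coinduced_rng
  have h2 : Continuous fun y : DistinctTuple X n =>
      (⟨y.1, y.injective⟩ : {y : Fin n → PosReal × X // Function.Injective y}) :=
    continuous_subtype_val.subtype_mk _
  exact (h1.comp (continuous_sigmaMk.comp h2)).measurable

/-- The map factors through finite pinpointing configurations: tuples map there continuously, and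
`toFinCone` is measurable by the choice of σ-algebra on its target. -/
theorem measurable_tupleMeasure (n : ℕ) :
    Measurable fun y : DistinctTuple X n => tupleMeasure y.1 := by
  have h : Measurable (toFinCone : PinFinConfig X → FinCone X) := fun s hs => hs
  simp_rw [← DistinctTuple.toFinCone_toPinFinConfig]
  exact h.comp (DistinctTuple.measurable_toPinFinConfig n)

theorem measurableSet_distinct (n : ℕ) :
    MeasurableSet {y : Fin n → PosReal × X | Function.Injective fun i => (y i).2} := by
  have : {y : Fin n → PosReal × X | Function.Injective fun i => (y i).2} =
      ⋂ (i) (j), {y | (y i).2 = (y j).2 → i = j} := by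
    ext y
    simp [Function.Injective]
  rw [this]
  refine MeasurableSet.iInter fun i => MeasurableSet.iInter fun j => ?_
  by_cases hij : i = j
  · simp [hij]
  · simp only [hij, imp_false]
    exact (measurableSet_eq_fun (by fun_prop) (by fun_prop)).compl

/-- The distinct `n`-tuples whose associated measure belongs to `A`. -/
def tupleSet (n : ℕ) (A : Set (FinCone X)) : Set (Fin n → PosReal × X) :=
  {y | (Function.Injective fun i => (y i).2) ∧ tupleMeasure y ∈ A}

theorem tupleSet_eq_image (n : ℕ) (A : Set (FinCone X)) :
    tupleSet n A = Subtype.val '' ((fun y : DistinctTuple X n => tupleMeasure y.1) ⁻¹' A) := by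
  ext y
  constructor
  · rintro ⟨h1, h2⟩
    exact ⟨⟨y, h1⟩, h2, rfl⟩
  · rintro ⟨z, hz, rfl⟩
    exact ⟨z.2, hz⟩

theorem measurableSet_tupleSet (n : ℕ) {A : Set (FinCone X)} (hA : MeasurableSet A) :
    MeasurableSet (tupleSet n A) := by
  rw [tupleSet_eq_image]
  exact (measurableSet_distinct n).subtype_image (measurable_tupleMeasure n hA)

end Points

/-! ### Exhaustion by bounded measurable sets -/

section Exhaustion

variable (X : Type*) [TopologicalSpace X] [PolishSpace X] [LocallyCompactSpace X]
  [MeasurableSpace X] [BorelSpace X]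

/-- An exhaustion of `(0, ∞) × X` by compact boxes. -/
def box (k : ℕ) : Set (PosReal × X) :=
  weightIcc (1 / ((k : ℝ) + 2)) ((k : ℝ) + 2) ×ˢ compactCovering X k

/-- An exhaustion of `𝕂₀(X)` by bounded measurable sets. -/
def exhaustion (k : ℕ) : Set (FinCone X) :=
  {ξ | ξ.toCone.points.ncard ≤ k ∧ ξ.toCone.points ⊆ box X k}

theorem isClosed_weightIcc (a b : ℝ) : IsClosed (weightIcc a b) :=
  (isClosed_le continuous_const continuous_subtype_val).inter
    (isClosed_le continuous_subtype_val continuous_const)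

theorem isClosed_box (k : ℕ) : IsClosed (box X k) :=
  (isClosed_weightIcc _ _).prod (isCompact_compactCovering X k).isClosed

theorem weightIcc_mono {a b c d : ℝ} (h1 : c ≤ a) (h2 : b ≤ d) : weightIcc a b ⊆ weightIcc c d :=
  fun _ hs => ⟨h1.trans hs.1, hs.2.trans h2⟩

theorem box_mono : Monotone (box X) := by
  intro k l hkl
  have h : (k : ℝ) ≤ l := by exact_mod_cast hkl
  refine prod_mono (weightIcc_mono ?_ (by linarith)) (compactCovering_subset X hkl)
  exact one_div_le_one_div_of_le (by positivity) (by linarith)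

theorem iUnion_box : ⋃ k, box X k = univ := by
  refine eq_univ_of_forall fun y => ?_
  obtain ⟨k, hk⟩ := mem_iUnion.1
    ((iUnion_compactCovering X).symm ▸ mem_univ y.2 : y.2 ∈ ⋃ n, compactCovering X n)
  obtain ⟨l, hl⟩ := exists_nat_gt (y.1 : ℝ)
  obtain ⟨j, hj⟩ := exists_nat_gt (1 / (y.1 : ℝ))
  have hpos : (0 : ℝ) < y.1 := y.1.2
  refine mem_iUnion.2 ⟨k + l + j, ⟨?_, ?_⟩, compactCovering_subset X (by omega) hk⟩
  · rw [one_div_le (by positivity) hpos]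
    push_cast
    linarith [k.cast_nonneg (α := ℝ), l.cast_nonneg (α := ℝ)]
  · push_cast
    linarith [k.cast_nonneg (α := ℝ), j.cast_nonneg (α := ℝ)]

theorem exhaustion_mono : Monotone (exhaustion X) :=
  fun _ _ hkl _ hξ => ⟨hξ.1.trans hkl, hξ.2.trans (box_mono X hkl)⟩

theorem iUnion_exhaustion : ⋃ k, exhaustion X k = univ := by
  refine eq_univ_of_forall fun ξ => ?_
  obtain ⟨k, hk⟩ := Directed.exists_mem_subset_of_finset_subset_biUnion
    (box_mono X).directed_le (s := ξ.pts) (by simp [iUnion_box])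
  rw [FinCone.coe_pts] at hk
  exact mem_iUnion.2 ⟨max k ξ.toCone.points.ncard, le_max_right _ _,
    hk.trans (box_mono X (le_max_left _ _))⟩

theorem measurableSet_exhaustion (k : ℕ) : MeasurableSet (exhaustion X k) := by
  change MeasurableSet (toFinCone ⁻¹' exhaustion X k)
  have h : (toFinCone ⁻¹' exhaustion X k : Set (PinFinConfig X)) = Subtype.val ⁻¹'
      {γ : FinConfig X | γ.carrier.ncard ≤ k ∧ γ.carrier ⊆ box X k} := by
    ext γ
    simp only [exhaustion, mem_preimage, mem_ofPred_eq, points_toFinCone]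
  rw [h]
  refine measurable_subtype_coe (IsClosed.measurableSet ?_)
  -- Closedness is tested on `n`-tuples of distinct points: for `n ≤ k` the preimage says that all
  -- coordinates lie in the closed box, and for `n > k` it is empty.
  refine isClosed_coinduced.2 (isClosed_sigma_iff.2 fun n => ?_)
  by_cases hn : n ≤ k
  · have : (Sigma.mk (β := fun n => {y : Fin n → PosReal × X // Function.Injective y}) n ⁻¹'
        (FinConfig.ofTuple ⁻¹'
        {γ : FinConfig X | γ.carrier.ncard ≤ k ∧ γ.carrier ⊆ box X k}) :
        Set {y : Fin n → PosReal × X // Function.Injective y}) =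
        ⋂ i, (fun y => y.1 i) ⁻¹' box X k := by
      ext y
      have hc : (range y.1).ncard = n := by
        rw [← image_univ, ncard_image_of_injective _ y.2, ncard_univ, Nat.card_eq_fintype_card,
          Fintype.card_fin]
      simp [FinConfig.ofTuple, hc, hn, range_subset_iff]
    rw [this]
    exact isClosed_iInter fun i =>
      (isClosed_box X k).preimage ((continuous_apply i).comp continuous_subtype_val)
  · convert isClosed_empty
    ext y
    have hc : (range y.1).ncard = n := by
      rw [← image_univ, ncard_image_of_injective _ y.2, ncard_univ, Nat.card_eq_fintype_card,
        Fintype.card_fin]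
    simp [FinConfig.ofTuple, hc, hn]

theorem isBoundedBorel_compactCovering (k : ℕ) : IsBoundedBorel (compactCovering X k) :=
  ⟨(isCompact_compactCovering X k).measurableSet, (isCompact_compactCovering X k).closure⟩

theorem one_div_add_two_lt (k : ℕ) : 1 / ((k : ℝ) + 2) < (k : ℝ) + 2 := by
  have : (0 : ℝ) ≤ k := k.cast_nonneg
  rw [div_lt_iff₀ (by positivity)]
  nlinarith

theorem isBoundedFinCone_exhaustion (k : ℕ) : IsBoundedFinCone (exhaustion X k) := by
  refine ⟨compactCovering X k, 1 / ((k : ℝ) + 2), (k : ℝ) + 2, k,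
    isBoundedBorel_compactCovering X k, by positivity, one_div_add_two_lt k, fun ξ hξ => ?_⟩
  refine ⟨?_, ?_, fun x hx => ?_⟩
  · rw [← ξ.toCone.snd_image_points]
    rintro _ ⟨y, hy, rfl⟩
    exact (hξ.2 hy).2
  · rw [← ξ.toCone.snd_image_points, ξ.toCone.snd_injOn_points.ncard_image]
    exact hξ.1
  · exact (hξ.2 (ξ.toCone.point_mem ⟨x, hx⟩)).1

variable {X}

theorem IsBoundedFinCone.mono {A B : Set (FinCone X)} (hB : IsBoundedFinCone B) (h : A ⊆ B) :
    IsBoundedFinCone A := by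
  obtain ⟨Λ, a, b, N, h1, h2, h3, h4⟩ := hB
  exact ⟨Λ, a, b, N, h1, h2, h3, fun ξ hξ => h4 ξ (h hξ)⟩

/-- Reduces uniqueness, measurability and absolute continuity to bounded sets. -/
theorem measure_eq_iSup_exhaustion (ρ : Measure (FinCone X)) (A : Set (FinCone X)) :
    ρ A = ⨆ k, ρ (A ∩ exhaustion X k) := by
  rw [← Monotone.measure_iUnion (fun k l h => inter_subset_inter_right A (exhaustion_mono X h)),
    ← inter_iUnion, iUnion_exhaustion, inter_univ]

end Exhaustion

/-! ### Ordered tuples versus subsets -/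

section Combinatorics

/-- A sum over injective tuples in a finite set, in terms of the sum over subsets. -/
theorem sum_injective_tuples {α : Type*} [DecidableEq α] (S : Finset α) (n : ℕ) (f : Finset α → ℝ≥0∞) :
    ∑ y ∈ Fintype.piFinset (fun _ : Fin n => S) with Function.Injective y,
        f (Finset.univ.image y) = (n.factorial : ℝ≥0∞) * ∑ t ∈ S.powersetCard n, f t := by
  have hmaps : ∀ y ∈ (Fintype.piFinset (fun _ : Fin n => S)).filter Function.Injective,
      Finset.univ.image y ∈ S.powersetCard n := by
    intro y hy
    obtain ⟨h1, h2⟩ := Finset.mem_filter.1 hy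
    refine Finset.mem_powersetCard.2 ⟨fun x hx => ?_, ?_⟩
    · obtain ⟨i, -, rfl⟩ := Finset.mem_image.1 hx
      exact Fintype.mem_piFinset.1 h1 i
    · rw [Finset.card_image_of_injective _ h2, Finset.card_univ, Fintype.card_fin]
  rw [← Finset.sum_fiberwise_of_maps_to hmaps, Finset.mul_sum]
  refine Finset.sum_congr rfl fun t ht => ?_
  obtain ⟨htS, htn⟩ := Finset.mem_powersetCard.1 ht
  rw [Finset.sum_congr rfl (g := fun _ => f t)
    (fun y hy => by rw [(Finset.mem_filter.1 hy).2]), Finset.sum_const, nsmul_eq_mul]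
  congr 2
  -- The injective tuples with image `t` are the bijections from `Fin n` to `t`, so every fibre has
  -- `n!` elements.
  have hcard : Fintype.card (Fin n ≃ t) = n.factorial := by
    rw [Fintype.card_equiv ((finCongr htn.symm).trans t.equivFin.symm), Fintype.card_fin]
  rw [← hcard, ← Finset.card_univ]
  symm
  refine Finset.card_bij (fun e _ j => (e j : α)) ?_ ?_ ?_
  · intro e _
    refine Finset.mem_filter.2 ⟨Finset.mem_filter.2 ⟨Fintype.mem_piFinset.2 fun i =>
      htS (e i).2, Subtype.val_injective.comp e.injective⟩, ?_⟩
    ext x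
    simp only [Finset.mem_image, Finset.mem_univ, true_and]
    exact ⟨fun ⟨i, hi⟩ => hi ▸ (e i).2, fun hx => ⟨e.symm ⟨x, hx⟩, by simp⟩⟩
  · intro e _ e' _ h
    exact Equiv.ext fun j => Subtype.ext (congrFun h j)
  · intro y hy
    obtain ⟨h1, h2⟩ := Finset.mem_filter.1 hy
    have hinj := (Finset.mem_filter.1 h1).2
    have hmem : ∀ j, y j ∈ t := fun j => h2 ▸ Finset.mem_image_of_mem y (Finset.mem_univ j)
    refine ⟨Equiv.ofBijective (fun j => (⟨y j, hmem j⟩ : t)) ⟨fun i j h =>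
      hinj (congrArg Subtype.val h), fun x => ?_⟩, Finset.mem_univ _, rfl⟩
    obtain ⟨j, -, hj⟩ := Finset.mem_image.1 (h2.symm ▸ x.2 : (x : α) ∈ Finset.univ.image y)
    exact ⟨j, Subtype.ext hj⟩

end Combinatorics

/-! ### The measure of finite sub-configurations and its measurability -/

section SubKernel

variable {X : Type*} [TopologicalSpace X] [PolishSpace X] [LocallyCompactSpace X]
  [MeasurableSpace X] [BorelSpace X]

theorem Cone.finite_points_inter_box (η : Cone X) (k : ℕ) : (η.points ∩ box X k).Finite :=
  η.finite_points_inter (by positivity) (η.isDiscreteRadon.1 _ (isCompact_compactCovering X k))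

/-- The points of `η` in the `k`-th box. -/
noncomputable def Cone.pointsIn (η : Cone X) (k : ℕ) : Finset (PosReal × X) :=
  (η.finite_points_inter_box k).toFinset

theorem Cone.mem_pointsIn {η : Cone X} {k : ℕ} {y : PosReal × X} :
    y ∈ η.pointsIn k ↔ y ∈ η.points ∧ y ∈ box X k := by
  rw [Cone.pointsIn, Finite.mem_toFinset, mem_inter_iff]

/-- The sum of the Dirac measures at the `n`-tuples of points of `η` in the `k`-th box. -/
noncomputable def Cone.tupleSum (k n : ℕ) (η : Cone X) : Measure (Fin n → PosReal × X) :=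
  ∑ y ∈ Fintype.piFinset (fun _ : Fin n => η.pointsIn k), Measure.dirac y

theorem Cone.tupleSum_apply (k n : ℕ) (η : Cone X) {E : Set (Fin n → PosReal × X)}
    (hE : MeasurableSet E) :
    η.tupleSum k n E = ∑ y ∈ Fintype.piFinset (fun _ : Fin n => η.pointsIn k),
      E.indicator (fun _ => 1) y := by
  rw [Cone.tupleSum, Measure.finsetSum_apply]
  exact Finset.sum_congr rfl fun y _ => Measure.dirac_apply' _ hE

theorem Cone.tupleSum_univ (k n : ℕ) (η : Cone X) :
    η.tupleSum k n univ = ((η.pointsIn k).card : ℝ≥0∞) ^ n := by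
  classical
  rw [Cone.tupleSum_apply _ _ _ MeasurableSet.univ]
  simp [Fintype.card_piFinset]

/-- Repeated points are allowed in `tupleSum`, which is what makes it a product on rectangles;
`tupleSet` discards the repetitions later. -/
theorem Cone.tupleSum_pi (k n : ℕ) (η : Cone X) {s : Fin n → Set (PosReal × X)}
    (hs : ∀ i, MeasurableSet (s i)) :
    η.tupleSum k n (pi univ s) =
      ∏ i, ∑' y : η.points, (s i ∩ box X k).indicator (fun _ => (1 : ℝ≥0∞)) y.1 := by
  classical
  rw [Cone.tupleSum_apply _ _ _ (MeasurableSet.univ_pi hs)]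
  have h1 : ∀ y : Fin n → PosReal × X, (pi univ s).indicator (fun _ => (1 : ℝ≥0∞)) y =
      ∏ i, (s i).indicator (fun _ => 1) (y i) := by
    intro y
    by_cases hy : y ∈ pi univ s
    · rw [indicator_of_mem hy, Finset.prod_eq_one fun i _ => indicator_of_mem (hy i trivial) _]
    · obtain ⟨i, hi⟩ : ∃ i, y i ∉ s i := by simpa using hy
      rw [indicator_of_notMem hy, Finset.prod_eq_zero (Finset.mem_univ i)
        (indicator_of_notMem hi _)]
  rw [Finset.sum_congr rfl fun y _ => h1 y,
    Finset.sum_prod_piFinset (η.pointsIn k) fun i p => (s i).indicator (fun _ => (1 : ℝ≥0∞)) p]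
  refine Finset.prod_congr rfl fun i _ => ?_
  rw [tsum_subtype η.points fun y => (s i ∩ box X k).indicator (fun _ => (1 : ℝ≥0∞)) y,
    tsum_eq_sum (s := η.pointsIn k)]
  · refine Finset.sum_congr rfl fun y hy => ?_
    obtain ⟨hy1, hy2⟩ := Cone.mem_pointsIn.1 hy
    rw [indicator_of_mem hy1]
    by_cases h : y ∈ s i
    · rw [indicator_of_mem h, indicator_of_mem (show y ∈ s i ∩ box X k from ⟨h, hy2⟩)]
    · rw [indicator_of_notMem h, indicator_of_notMem fun h' => h h'.1]
  · intro y hy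
    by_cases hy1 : y ∈ η.points
    · rw [indicator_of_mem hy1, indicator_of_notMem fun h => hy (Cone.mem_pointsIn.2 ⟨hy1, h.2⟩)]
    · rw [indicator_of_notMem hy1]

theorem measurableSet_box (k : ℕ) : MeasurableSet (box X k) := (isClosed_box X k).measurableSet

theorem Cone.measurable_tupleSum (k n : ℕ) : Measurable (Cone.tupleSum (X := X) k n) := by
  have hfin : ∀ η : Cone X, IsFiniteMeasure (η.tupleSum k n) := fun η =>
    ⟨by rw [Cone.tupleSum_univ]; exact ENNReal.pow_lt_top (ENNReal.natCast_lt_top _)⟩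
  have hrect : ∀ s : Fin n → Set (PosReal × X), (∀ i, MeasurableSet (s i)) →
      Measurable fun η : Cone X => η.tupleSum k n (pi univ s) := by
    intro s hs
    simp_rw [Cone.tupleSum_pi k n _ hs]
    exact Finset.measurable_fun_prod _ fun i _ =>
      Cone.measurable_tsum_points ((hs i).inter (measurableSet_box k))
  refine Measurable.measure_of_isPiSystem generateFrom_pi.symm isPiSystem_pi ?_ ?_
  · rintro _ ⟨s, hs, rfl⟩
    exact hrect s fun i => hs i trivial
  · simpa using hrect (fun _ => univ) fun _ => MeasurableSet.univ

/-- The measure `∑_{ξ ⋐ η} δ_ξ`. -/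
noncomputable def subKernel (η : Cone X) : Measure (FinCone X) :=
  Measure.sum fun ξ : {ξ : FinCone X // ξ.IsSub η} => Measure.dirac ξ.1

theorem subKernel_apply (η : Cone X) {A : Set (FinCone X)} (hA : MeasurableSet A) :
    subKernel η A = ∑' ξ : {ξ : FinCone X // ξ.IsSub η}, A.indicator (fun _ => 1) ξ.1 := by
  rw [subKernel, Measure.sum_apply _ hA]
  exact tsum_congr fun ξ => Measure.dirac_apply' _ hA

/-- The map `FinCone.pts` identifies the `ξ ⋐ η` with the finite subsets of the points of `η`; those
in `A` use only points of the box. -/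
theorem subKernel_eq_sum_powerset (η : Cone X) {k : ℕ} {A : Set (FinCone X)}
    (hA : MeasurableSet A) (hAk : A ⊆ exhaustion X k) :
    subKernel η A = ∑ t ∈ (η.pointsIn k).powerset,
      (FinCone.pts '' A).indicator (fun _ => (1 : ℝ≥0∞)) t := by
  classical
  let g : Finset (PosReal × X) → ℝ≥0∞ := fun t =>
    if t ⊆ η.pointsIn k then (FinCone.pts '' A).indicator (fun _ => 1) t else 0
  have hsub : ∀ {ξ : FinCone X}, ξ.IsSub η → ξ ∈ A → ξ.pts ⊆ η.pointsIn k := by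
    intro ξ h hξ y hy
    have hy' : y ∈ ξ.toCone.points := ξ.coe_pts ▸ Finset.mem_coe.2 hy
    exact Cone.mem_pointsIn.2 ⟨FinCone.isSub_iff.1 h hy', (hAk hξ).2 hy'⟩
  have hg : ∀ ξ : {ξ : FinCone X // ξ.IsSub η}, A.indicator (fun _ => (1 : ℝ≥0∞)) ξ.1 =
      g ξ.1.pts := by
    intro ξ
    by_cases h : ξ.1 ∈ A
    · simp only [g, if_pos (hsub ξ.2 h), indicator_of_mem h,
        indicator_of_mem (mem_image_of_mem FinCone.pts h)]
    · have : ξ.1.pts ∉ FinCone.pts '' A := fun h' => h (FinCone.pts_injective.mem_set_image.1 h')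
      simp only [g, indicator_of_notMem h, indicator_of_notMem this, ite_self]
  have hinj : Function.Injective fun ξ : {ξ : FinCone X // ξ.IsSub η} => ξ.1.pts :=
    FinCone.pts_injective.comp Subtype.val_injective
  have hsupp : Function.support g ⊆ range fun ξ : {ξ : FinCone X // ξ.IsSub η} => ξ.1.pts := by
    intro t ht
    by_cases h : t ⊆ η.pointsIn k
    · have hmem : ∀ y ∈ t, y ∈ η.points := fun y hy => (Cone.mem_pointsIn.1 (h hy)).1
      obtain ⟨ξ, rfl⟩ := exists_pts_eq (η := η) (t := t) hmem
      refine ⟨⟨ξ, FinCone.isSub_iff.2 ?_⟩, rfl⟩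
      rw [← ξ.coe_pts]
      exact hmem
    · exact absurd (if_neg h) ht
  rw [subKernel_apply η hA, tsum_congr hg, hinj.tsum_eq hsupp,
    tsum_eq_sum (s := (η.pointsIn k).powerset)]
  · exact Finset.sum_congr rfl fun t ht => if_pos (Finset.mem_powerset.1 ht)
  · exact fun t ht => if_neg fun h => ht (Finset.mem_powerset.2 h)

theorem Cone.tupleSum_tupleSet (η : Cone X) (k n : ℕ) {A : Set (FinCone X)}
    (hA : MeasurableSet A) :
    η.tupleSum k n (tupleSet n A) = (n.factorial : ℝ≥0∞) *
      ∑ t ∈ (η.pointsIn k).powersetCard n,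
        (FinCone.pts '' A).indicator (fun _ => (1 : ℝ≥0∞)) t := by
  classical
  rw [← sum_injective_tuples, Finset.sum_filter, Cone.tupleSum_apply _ _ _
    (measurableSet_tupleSet n hA)]
  refine Finset.sum_congr rfl fun y hy => ?_
  have hmem : ∀ i, y i ∈ η.points := fun i =>
    (Cone.mem_pointsIn.1 (Fintype.mem_piFinset.1 hy i)).1
  by_cases hinj : Function.Injective y
  · have hinj' : Function.Injective fun i => (y i).2 := fun i j h =>
      hinj (η.snd_injOn_points (hmem i) (hmem j) h)
    have hpts : Finset.univ.image y = (tupleMeasure y).pts := by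
      refine Finset.coe_injective ?_
      rw [FinCone.coe_pts, points_tupleMeasure hinj']
      simp
    rw [if_pos hinj, hpts]
    have hiff : y ∈ tupleSet n A ↔ (tupleMeasure y).pts ∈ FinCone.pts '' A := by
      rw [FinCone.pts_injective.mem_set_image]
      exact ⟨fun h => h.2, fun h => ⟨hinj', h⟩⟩
    simp only [indicator_apply, hiff]
  · rw [if_neg hinj, indicator_of_notMem]
    exact fun h => hinj fun i j hij => h.1 (congrArg Prod.snd hij)

theorem subKernel_eq_tsum (η : Cone X) {k : ℕ} {A : Set (FinCone X)}
    (hA : MeasurableSet A) (hAk : A ⊆ exhaustion X k) :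
    subKernel η A = ∑' n : ℕ, (n.factorial : ℝ≥0∞)⁻¹ * η.tupleSum k n (tupleSet n A) := by
  have h : ∀ n : ℕ, (n.factorial : ℝ≥0∞)⁻¹ * η.tupleSum k n (tupleSet n A) =
      ∑ t ∈ (η.pointsIn k).powersetCard n,
        (FinCone.pts '' A).indicator (fun _ => (1 : ℝ≥0∞)) t := by
    intro n
    rw [η.tupleSum_tupleSet k n hA, ← mul_assoc, ENNReal.inv_mul_cancel
      (by exact_mod_cast n.factorial_ne_zero) (ENNReal.natCast_ne_top _), one_mul]
  rw [subKernel_eq_sum_powerset η hA hAk, tsum_congr h, Finset.sum_powerset,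
    tsum_eq_sum (s := Finset.range ((η.pointsIn k).card + 1))]
  intro n hn
  rw [Finset.powersetCard_eq_empty.2 (by simpa using hn), Finset.sum_empty]

theorem measurable_subKernel : Measurable (subKernel : Cone X → Measure (FinCone X)) := by
  refine Measure.measurable_of_measurable_coe _ fun A hA => ?_
  simp_rw [measure_eq_iSup_exhaustion _ A]
  refine Measurable.iSup fun k => ?_
  have hAk := hA.inter (measurableSet_exhaustion X k)
  simp_rw [subKernel_eq_tsum _ hAk inter_subset_right]
  exact Measurable.tsum fun n => ((Measure.measurable_coe (measurableSet_tupleSet n hAk)).comp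
    (Cone.measurable_tupleSum k n)).const_mul _

theorem tupleSet_exhaustion_subset (k n : ℕ) :
    tupleSet n (exhaustion X k) ⊆ pi univ fun _ => box X k := by
  intro y hy i _
  have h := hy.2.2
  rw [points_tupleMeasure hy.1] at h
  exact h (mem_range_self i)

theorem tupleSet_exhaustion_eq_empty {k n : ℕ} (h : k < n) :
    tupleSet n (exhaustion X k) = ∅ := by
  refine eq_empty_of_forall_notMem fun y hy => ?_
  have h1 := hy.2.1
  rw [points_tupleMeasure hy.1, ← image_univ, ncard_image_of_injective _
    fun i j hij => hy.1 (congrArg Prod.snd hij), ncard_univ, Nat.card_eq_fintype_card,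
    Fintype.card_fin] at h1
  omega

/-- Each point in the box has weight at least `1 / (k + 2)`, so there are at most `(k + 2) η(K)` of
them, `K` being the compact base. The bound is polynomial in `η(K)`, hence integrable under the
moment condition. -/
theorem subKernel_exhaustion_le (η : Cone X) (k : ℕ) :
    subKernel η (exhaustion X k) ≤ ∑ n ∈ Finset.range (k + 1),
      (ENNReal.ofReal ((k : ℝ) + 2)) ^ n * η.toMeasure (compactCovering X k) ^ n := by
  rw [subKernel_eq_tsum η (measurableSet_exhaustion X k) subset_rfl,
    tsum_eq_sum (s := Finset.range (k + 1))]
  · refine Finset.sum_le_sum fun n _ => ?_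
    calc (n.factorial : ℝ≥0∞)⁻¹ * η.tupleSum k n (tupleSet n (exhaustion X k))
        ≤ 1 * η.tupleSum k n univ := by
          gcongr
          · exact ENNReal.inv_le_one.2 (by exact_mod_cast n.factorial_pos)
          · exact subset_univ _
      _ = ((η.pointsIn k).card : ℝ≥0∞) ^ n := by rw [one_mul, Cone.tupleSum_univ]
      _ ≤ (ENNReal.ofReal ((k : ℝ) + 2) * η.toMeasure (compactCovering X k)) ^ n := by
          gcongr
          have hpos : (0 : ℝ) < (k : ℝ) + 2 := by positivity
          have h := η.card_mul_le (a := 1 / ((k : ℝ) + 2)) (Λ := compactCovering X k)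
            (t := η.pointsIn k) (fun y hy => (Cone.mem_pointsIn.1 hy).1)
            (fun y hy => ⟨(Cone.mem_pointsIn.1 hy).2.1.1, (Cone.mem_pointsIn.1 hy).2.2⟩)
          calc ((η.pointsIn k).card : ℝ≥0∞) = ENNReal.ofReal ((k : ℝ) + 2) *
                ((η.pointsIn k).card * ENNReal.ofReal (1 / ((k : ℝ) + 2))) := by
                rw [mul_left_comm, ← ENNReal.ofReal_mul hpos.le, mul_one_div_cancel hpos.ne',
                  ENNReal.ofReal_one, mul_one]
            _ ≤ _ := by gcongr
      _ = _ := mul_pow _ _ _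
  · intro n hn
    rw [tupleSet_exhaustion_eq_empty (by simpa using hn), measure_empty, mul_zero]

/-- For a bounded measurable `A`, the `K`-transform of its indicator counts the `ξ ⋐ η` in `A`. -/
theorem ofReal_kTransform_indicator (η : Cone X) {A : Set (FinCone X)} (hA : MeasurableSet A)
    (hAb : IsBoundedFinCone A) :
    ENNReal.ofReal (kTransform (A.indicator fun _ => 1) η) = subKernel η A := by
  classical
  obtain ⟨Λ, a, b, N, hΛ, ha, -, h⟩ := hAb
  have hΛη : η.toMeasure Λ < ∞ :=
    (measure_mono subset_closure).trans_lt (η.isDiscreteRadon.1 _ hΛ.2)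
  have hfin := η.finite_points_inter (b := b) ha hΛη
  have hsupp : (Function.support fun ξ : {ξ : FinCone X // ξ.IsSub η} =>
      A.indicator (fun _ => (1 : ℝ)) ξ.1).Finite := by
    have hinj : Function.Injective fun ξ : {ξ : FinCone X // ξ.IsSub η} => ξ.1.pts :=
      FinCone.pts_injective.comp Subtype.val_injective
    refine Finite.of_finite_image ((hfin.toFinset.powerset.finite_toSet).subset ?_) hinj.injOn
    rintro _ ⟨ξ, hξ, rfl⟩
    have hξA : ξ.1 ∈ A := by
      by_contra hn
      exact hξ (indicator_of_notMem hn _)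
    refine Finset.mem_coe.2 (Finset.mem_powerset.2 fun y hy => ?_)
    have hy' : y ∈ ξ.1.toCone.points := ξ.1.coe_pts ▸ Finset.mem_coe.2 hy
    have hys := Cone.mem_supp_of_mem_points hy'
    obtain ⟨h1, -, h3⟩ := h ξ.1 hξA
    have h4 := h3 _ hys
    rw [show ξ.1.toCone.weight y.2 = y.1 from hy'] at h4
    exact (Finite.mem_toFinset _).2 ⟨FinCone.isSub_iff.1 ξ.2 hy', h4, h1 hys⟩
  -- The real `tsum` would default to 0 without summability; boundedness of `A` leaves only finitely
  -- many non-zero terms.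
  rw [kTransform, ENNReal.ofReal_tsum_of_nonneg
    (fun ξ => indicator_nonneg (fun _ _ => zero_le_one) _) (summable_of_hasFiniteSupport hsupp),
    subKernel_apply η hA]
  refine tsum_congr fun ξ => ?_
  by_cases hξ : ξ.1 ∈ A
  · simp [hξ]
  · simp [hξ]

theorem subKernel_ne_zero_iff (η : Cone X) {A : Set (FinCone X)} (hA : MeasurableSet A) :
    subKernel η A ≠ 0 ↔ ∃ ξ ∈ A, ξ.IsSub η := by
  rw [subKernel_apply η hA, ne_eq, ENNReal.tsum_eq_zero]
  push Not
  constructor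
  · rintro ⟨ξ, hξ⟩
    exact ⟨ξ.1, mem_of_indicator_ne_zero hξ, ξ.2⟩
  · rintro ⟨ξ, hξA, hξ⟩
    exact ⟨⟨ξ, hξ⟩, by simp [hξA]⟩

end SubKernel

/-! ### Null sets of tuples for Poisson configurations -/

section Poisson

variable {X : Type*} [TopologicalSpace X] [PolishSpace X] [LocallyCompactSpace X]
  [MeasurableSpace X] [BorelSpace X]

theorem isCompact_weightIcc {a b : ℝ} (ha : 0 < a) : IsCompact (weightIcc a b) := by
  refine Topology.IsEmbedding.subtypeVal.isCompact_iff.2 ?_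
  convert isCompact_Icc (a := a) (b := b)
  ext s
  constructor
  · rintro ⟨t, ht, rfl⟩
    exact ht
  · exact fun hs => ⟨⟨s, ha.trans_le hs.1⟩, hs, rfl⟩

theorem isCompact_box (k : ℕ) : IsCompact (box X k) :=
  (isCompact_weightIcc (by positivity)).prod (isCompact_compactCovering X k)

theorem Config.finite_inter (γ : Config X) {B : Set (PosReal × X)} (hB : IsBoundedBorel B) :
    (γ.carrier ∩ B).Finite := by
  rcases B.eq_empty_or_nonempty with rfl | hne
  · simp
  have hK : IsCompact ((fun y : PosReal × X => (y.1 : ℝ)) '' closure B) :=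
    hB.2.image (by fun_prop)
  have hKne : ((fun y : PosReal × X => (y.1 : ℝ)) '' closure B).Nonempty := hne.closure.image _
  obtain ⟨a, ⟨z, -, hz⟩, hmin⟩ := hK.exists_isLeast hKne
  obtain ⟨b, hb, hmax⟩ := hK.exists_isGreatest hKne
  have ha : 0 < a := by
    rw [← hz]
    exact z.1.2
  -- The extreme weights `a` and `b` may coincide, while local finiteness is stated for strict
  -- inequality.
  have hab : a < b + 1 := (hmin hb).trans_lt (lt_add_one b)
  have hΛ : IsCompact (Prod.snd '' closure B) := hB.2.image continuous_snd
  refine (γ.locallyFinite (Prod.snd '' closure B) a (b + 1) ⟨hΛ.measurableSet, hΛ.closure⟩ ha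
    hab).subset (inter_subset_inter_right _ fun y hy => ?_)
  have hy' := subset_closure hy
  have h1 := mem_image_of_mem (fun y : PosReal × X => (y.1 : ℝ)) hy'
  exact ⟨⟨hmin h1, (hmax h1).trans (lt_add_one b).le⟩, mem_image_of_mem _ hy'⟩

theorem Config.count_ne_zero_iff (γ : Config X) {B : Set (PosReal × X)} (hB : IsBoundedBorel B) :
    γ.count B ≠ 0 ↔ (γ.carrier ∩ B).Nonempty := by
  rw [Config.count, ne_eq, ncard_eq_zero (γ.finite_inter hB), nonempty_iff_ne_empty]

theorem poissonMeasure_compl_zero_le (r : ℝ≥0) :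
    ProbabilityTheory.poissonMeasure r {0}ᶜ ≤ r := by
  rw [prob_compl_eq_one_sub (measurableSet_singleton 0),
    ProbabilityTheory.poissonMeasure_singleton]
  simp only [pow_zero, mul_one, Nat.factorial_zero, Nat.cast_one, div_one]
  rw [← ENNReal.ofReal_one, ← ENNReal.ofReal_sub _ (Real.exp_pos _).le,
    ← ENNReal.ofReal_coe_nnreal]
  refine ENNReal.ofReal_le_ofReal ?_
  linarith [Real.add_one_le_exp (-(r : ℝ))]

variable {m : Measure (PosReal × X)} {π : Measure (Config X)}

theorem IsPoissonMeasure.measure_count_ne_zero_le (hπ : IsPoissonMeasure m π)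
    {B : Set (PosReal × X)} (hB : IsBoundedBorel B) :
    π (Config.count B ⁻¹' {0}ᶜ) ≤ m B := by
  have hlaw := hπ.law_count B hB
  have hae : AEMeasurable (Config.count B) π := by
    -- A map that is not a.e.-measurable would push `π` forward to 0, which is not a Poisson law.
    by_contra h
    rw [Measure.map_of_not_aemeasurable h] at hlaw
    exact IsProbabilityMeasure.ne_zero _ hlaw.symm
  rw [← Measure.map_apply_of_aemeasurable hae (measurableSet_singleton 0).compl, hlaw]
  exact (poissonMeasure_compl_zero_le _).trans ENNReal.coe_toNNReal_le_self

theorem IsPoissonMeasure.measure_forall_nonempty_le (hπ : IsPoissonMeasure m π) {n : ℕ}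
    {B : Fin n → Set (PosReal × X)} (hB : ∀ i, IsBoundedBorel (B i))
    (hd : Pairwise (Function.onFun Disjoint B)) :
    π {γ | ∀ i, (γ.carrier ∩ B i).Nonempty} ≤ ∏ i, m (B i) := by
  have h := (hπ.indep_count n B hB hd).measure_inter_preimage_eq_mul Finset.univ
    (sets := fun _ => {0}ᶜ) fun _ _ => (measurableSet_singleton 0).compl
  have hset : {γ : Config X | ∀ i, (γ.carrier ∩ B i).Nonempty} =
      ⋂ i ∈ Finset.univ, Config.count (B i) ⁻¹' {0}ᶜ := by
    ext γ
    simp [← Config.count_ne_zero_iff γ (hB _)]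
  rw [hset, h]
  exact Finset.prod_le_prod' fun i _ => hπ.measure_count_ne_zero_le (hB i)

/-- As a function of `E`, the left side is an outer measure. On rectangles, independence and `1 -
e^{-r} ≤ r` bound it by the product of the intensities, and `OuterMeasure.pi` is the largest outer
measure with that bound. -/
theorem IsPoissonMeasure.measure_exists_tuple_le (hπ : IsPoissonMeasure m π) {n : ℕ}
    {B : Fin n → Set (PosReal × X)} (hB : ∀ i, IsBoundedBorel (B i))
    (hd : Pairwise (Function.onFun Disjoint B)) {E : Set (Fin n → PosReal × X)}
    (hE : MeasurableSet E) :
    π {γ | ∃ y ∈ E, ∀ i, y i ∈ γ.carrier ∩ B i} ≤ Measure.pi (fun _ => m) E := by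
  let Θ : OuterMeasure (Fin n → PosReal × X) :=
    { measureOf := fun E => π {γ | ∃ y ∈ E, ∀ i, y i ∈ γ.carrier ∩ B i}
      empty := by simp
      mono := fun {E F} h => measure_mono fun γ ⟨y, hy, hγ⟩ => ⟨y, h hy, hγ⟩
      iUnion_nat := fun s _ => by
        refine (measure_mono fun γ hγ => ?_).trans (measure_iUnion_le _)
        obtain ⟨y, hy, hγ⟩ := hγ
        obtain ⟨j, hj⟩ := mem_iUnion.1 hy
        exact mem_iUnion.2 ⟨j, y, hj, hγ⟩ }
  have hΘ : Θ ≤ OuterMeasure.pi fun _ : Fin n => m.toOuterMeasure := by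
    refine OuterMeasure.le_pi.2 fun s _ => ?_
    -- The sides of the rectangle are arbitrary sets, so they are replaced by measurable hulls of
    -- equal measure.
    have hB' : ∀ i, IsBoundedBorel (toMeasurable m (s i) ∩ B i) := fun i =>
      ⟨(measurableSet_toMeasurable _ _).inter (hB i).1,
        (hB i).2.of_isClosed_subset isClosed_closure (closure_mono inter_subset_right)⟩
    have hd' : Pairwise (Function.onFun Disjoint fun i => toMeasurable m (s i) ∩ B i) :=
      fun i j hij => (hd hij).mono inter_subset_right inter_subset_right
    calc Θ (pi univ s)
        ≤ π {γ | ∀ i, (γ.carrier ∩ (toMeasurable m (s i) ∩ B i)).Nonempty} := by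
          refine measure_mono fun γ hγ i => ?_
          obtain ⟨y, hy, hyγ⟩ := hγ
          exact ⟨y i, (hyγ i).1, subset_toMeasurable _ _ (hy i trivial), (hyγ i).2⟩
      _ ≤ ∏ i, m (toMeasurable m (s i) ∩ B i) := hπ.measure_forall_nonempty_le hB' hd'
      _ ≤ ∏ i, m (s i) := Finset.prod_le_prod' fun i _ =>
          (measure_mono inter_subset_left).trans_eq (measure_toMeasurable _)
  rw [Measure.pi, toMeasure_apply _ _ hE]
  exact hΘ E

/-- Almost surely, no tuple of distinct points of a Poisson configuration lies in a given null set
of the product of the intensity measure. -/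
theorem IsPoissonMeasure.measure_exists_tuple_eq_zero (hπ : IsPoissonMeasure m π) {n : ℕ}
    {E : Set (Fin n → PosReal × X)} (hE : MeasurableSet E)
    (hE0 : Measure.pi (fun _ => m) E = 0) :
    π {γ | ∃ y ∈ E, Function.Injective y ∧ ∀ i, y i ∈ γ.carrier} = 0 := by
  have hb := TopologicalSpace.isBasis_countableBasis (PosReal × X)
  have := (TopologicalSpace.countable_countableBasis (PosReal × X)).to_subtype
  -- Countably many families of disjoint bounded sets, enough to separate the entries of every
  -- injective tuple: basic open sets do the separating, and boxes make them bounded.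
  let ι := {c : Fin n → TopologicalSpace.countableBasis (PosReal × X) × ℕ //
    Pairwise (Function.onFun Disjoint fun i => ((c i).1 : Set (PosReal × X)) ∩ box X (c i).2)}
  have hnull : ∀ c : ι, π {γ | ∃ y ∈ E, ∀ i, y i ∈ γ.carrier ∩
      (((c.1 i).1 : Set (PosReal × X)) ∩ box X (c.1 i).2)} = 0 := by
    intro c
    refine le_antisymm ((hπ.measure_exists_tuple_le (fun i => ⟨?_, ?_⟩) c.2 hE).trans hE0.le) bot_le
    · exact (hb.isOpen (c.1 i).1.2).measurableSet.inter (measurableSet_box _)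
    · exact (isCompact_box (c.1 i).2).of_isClosed_subset isClosed_closure
        (closure_minimal inter_subset_right (isClosed_box X _))
  refine measure_mono_null (fun γ hγ => ?_) (measure_iUnion_null hnull)
  obtain ⟨y, hyE, hinj, hyγ⟩ := hγ
  obtain ⟨U, hU, hUd⟩ := (finite_range y).t2_separation
  have hex : ∀ i, ∃ V ∈ TopologicalSpace.countableBasis (PosReal × X), y i ∈ V ∧ V ⊆ U (y i) :=
    fun i => hb.exists_subset_of_mem_open (hU (y i)).1 (hU (y i)).2
  choose V hV hyV hVU using hex
  have hbox : ∀ i, ∃ k, y i ∈ box X k := fun i => mem_iUnion.1 ((iUnion_box X).symm ▸ mem_univ _)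
  choose k hk using hbox
  refine mem_iUnion.2 ⟨⟨fun i => (⟨V i, hV i⟩, k i), fun i j hij => ?_⟩, y, hyE, fun i =>
    ⟨hyγ i, hyV i, hk i⟩⟩
  exact (hUd (mem_range_self i) (mem_range_self j) (hinj.ne hij)).mono
    (inter_subset_left.trans (hVU i)) (inter_subset_left.trans (hVU j))

end Poisson

/-! ### The Lebesgue–Poisson measure: null sets and σ-finiteness -/

section LebesguePoisson

variable {X : Type*} [TopologicalSpace X] [PolishSpace X] [LocallyCompactSpace X]
  [MeasurableSpace X] [BorelSpace X]

theorem lebesguePoisson_apply (m : Measure (PosReal × X)) {A : Set (FinCone X)}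
    (hA : MeasurableSet A) :
    lebesguePoisson m A =
      ∑' n : ℕ, (n.factorial : ℝ≥0∞)⁻¹ * Measure.pi (fun _ : Fin n => m) (tupleSet n A) := by
  rw [lebesguePoisson, Measure.sum_apply _ hA]
  refine tsum_congr fun n => ?_
  have h := Measure.comap_apply (Subtype.val : DistinctTuple X n → _) Subtype.val_injective
    (fun s hs => (measurableSet_distinct n).subtype_image hs) (Measure.pi fun _ : Fin n => m)
    (measurable_tupleMeasure n hA)
  rw [Measure.smul_apply, Measure.map_apply (measurable_tupleMeasure n) hA, h,
    tupleSet_eq_image, smul_eq_mul]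

theorem pi_tupleSet_eq_zero {m : Measure (PosReal × X)} {A : Set (FinCone X)}
    (hA : MeasurableSet A) (h : lebesguePoisson m A = 0) (n : ℕ) :
    Measure.pi (fun _ : Fin n => m) (tupleSet n A) = 0 := by
  rw [lebesguePoisson_apply m hA, ENNReal.tsum_eq_zero] at h
  exact (mul_eq_zero.1 (h n)).resolve_left
    (ENNReal.inv_ne_zero.2 (ENNReal.natCast_ne_top _))

theorem sigmaFinite_of_exhaustion {ρ : Measure (FinCone X)}
    (h : ∀ k, ρ (exhaustion X k) < ∞) : SigmaFinite ρ :=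
  ⟨⟨{ set := exhaustion X
      set_mem := fun _ => trivial
      finite := h
      spanning := iUnion_exhaustion X }⟩⟩

theorem sigmaFinite_lebesguePoisson (m : Measure (PosReal × X)) [SigmaFinite m]
    [IsFiniteMeasureOnCompacts m] : SigmaFinite (lebesguePoisson m) := by
  refine sigmaFinite_of_exhaustion fun k => ?_
  rw [lebesguePoisson_apply m (measurableSet_exhaustion X k),
    tsum_eq_sum (s := Finset.range (k + 1))]
  · refine ENNReal.sum_lt_top.2 fun n _ => ENNReal.mul_lt_top ?_ ?_
    · exact ENNReal.inv_lt_top.2 (by exact_mod_cast n.factorial_pos)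
    · refine (measure_mono (tupleSet_exhaustion_subset k n)).trans_lt ?_
      rw [Measure.pi_pi]
      exact ENNReal.prod_lt_top fun _ _ => (isCompact_box k).measure_lt_top
  · intro n hn
    rw [tupleSet_exhaustion_eq_empty (by simpa using hn), measure_empty, mul_zero]

end LebesguePoisson

/-! ### The correlation measure -/

section Correlation

variable {X : Type*} [TopologicalSpace X] [PolishSpace X] [LocallyCompactSpace X]
  [MeasurableSpace X] [BorelSpace X]

theorem points_proj (Λ : Set X) (a b : ℝ) (η : Cone X) :
    (Cone.proj Λ a b η).points = η.points ∩ weightIcc a b ×ˢ Λ := by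
  classical
  have hw : ∀ x, (Cone.proj Λ a b η).toMeasure {x} =
      if x ∈ Λ ∩ η.supp ∧ η.weight x ∈ Set.Icc a b then η.toMeasure {x} else 0 := by
    intro x
    change (η.toMeasure.restrict {x | x ∈ Λ ∩ η.supp ∧ η.weight x ∈ Set.Icc a b}) {x} = _
    rw [Measure.restrict_apply (measurableSet_singleton x)]
    split_ifs with h
    · congr 1
      exact inter_eq_self_of_subset_left (singleton_subset_iff.2 h)
    · refine measure_mono_null (fun z hz => ?_) measure_empty
      exact h (mem_singleton_iff.1 hz.1 ▸ hz.2)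
  ext y
  constructor
  · intro hy
    have hs := Cone.mem_supp_of_mem_points hy
    have hy' : (Cone.proj Λ a b η).weight y.2 = y.1 := hy
    rw [Cone.mem_supp, hw] at hs
    rw [Cone.weight, Measure.real_def, hw] at hy'
    split_ifs at hs hy' with h
    · have hη : η.weight y.2 = y.1 := hy'
      exact ⟨hη, by rw [weightIcc, mem_ofPred_eq, ← hη]; exact h.2, h.1.1⟩
    · exact absurd hs (lt_irrefl _)
  · rintro ⟨hy, hyI, hyΛ⟩
    have hη : η.weight y.2 = y.1 := hy
    change (Cone.proj Λ a b η).weight y.2 = y.1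
    rw [Cone.weight, Measure.real_def, hw, if_pos]
    · exact hη
    · exact ⟨⟨hyΛ, Cone.mem_supp_of_mem_points hy⟩, by rw [hη]; exact hyI⟩

theorem coneMeasure_eq_zero {π : Measure (Config X)} {S : Set (Cone X)} (hS : MeasurableSet S)
    (h : π (Subtype.val '' (toCone ⁻¹' S)) = 0) : coneMeasure π S = 0 := by
  rw [coneMeasure]
  -- No measurability of `toCone` is needed: without it the push-forward is 0 by convention.
  by_cases hm : AEMeasurable toCone (π.comap (Subtype.val : PinConfig X → Config X))
  · rw [Measure.map_apply_of_aemeasurable hm hS]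
    exact le_antisymm
      ((Measure.comap_apply_le _ _ (hm.nullMeasurableSet_preimage hS)).trans h.le) bot_le
  · rw [Measure.map_of_not_aemeasurable hm, Measure.coe_zero, Pi.zero_apply]

/-- Under the law `π_𝕂`, almost surely no `ξ ⋐ η` lies in a given null set of the Lebesgue–Poisson
measure. -/
theorem coneMeasure_exists_isSub_eq_zero {m : Measure (PosReal × X)} {π : Measure (Config X)}
    (hπ : IsPoissonMeasure m π) {A : Set (FinCone X)} (hA : MeasurableSet A)
    (h0 : lebesguePoisson m A = 0) : coneMeasure π {η | subKernel η A ≠ 0} = 0 := by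
  refine coneMeasure_eq_zero (((Measure.measurable_coe hA).comp measurable_subKernel)
    (measurableSet_singleton 0).compl) ?_
  refine measure_mono_null ?_ (measure_iUnion_null fun n =>
    hπ.measure_exists_tuple_eq_zero (measurableSet_tupleSet n hA) (pi_tupleSet_eq_zero hA h0 n))
  rintro _ ⟨γ, hγ, rfl⟩
  obtain ⟨ξ, hξA, hξ⟩ := (subKernel_ne_zero_iff _ hA).1 hγ
  obtain ⟨n, y, hy, rfl⟩ := exists_tupleMeasure_eq ξ
  rw [FinCone.isSub_iff, points_tupleMeasure hy, points_toCone] at hξ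
  exact mem_iUnion.2 ⟨n, y, ⟨hy, hξA⟩, fun i j h => hy (congrArg Prod.snd h),
    fun i => hξ (mem_range_self i)⟩

/-- This projection keeps exactly the points of `η` in `box X k`, and every `ξ ∈ A` has all its
points there. -/
theorem preimage_proj_subKernel_ne_zero {A : Set (FinCone X)} (hA : MeasurableSet A) {k : ℕ}
    (hAk : A ⊆ exhaustion X k) :
    Cone.proj (compactCovering X k) (1 / ((k : ℝ) + 2)) ((k : ℝ) + 2) ⁻¹'
      {η | subKernel η A ≠ 0} = {η | subKernel η A ≠ 0} := by
  ext η
  change subKernel _ A ≠ 0 ↔ subKernel η A ≠ 0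
  rw [subKernel_ne_zero_iff _ hA, subKernel_ne_zero_iff _ hA]
  refine exists_congr fun ξ => and_congr_right fun hξ => ?_
  rw [FinCone.isSub_iff, FinCone.isSub_iff, points_proj, subset_inter_iff]
  exact and_iff_left (hAk hξ).2

theorem bind_subKernel_apply (μ : Measure (Cone X)) {A : Set (FinCone X)} (hA : MeasurableSet A) :
    μ.bind subKernel A = ∫⁻ η, subKernel η A ∂μ :=
  Measure.bind_apply hA measurable_subKernel.aemeasurable

theorem isCorrelationMeasure_bind_subKernel (μ : Measure (Cone X)) :
    IsCorrelationMeasure μ (μ.bind subKernel) := by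
  intro A hA hAb
  rw [bind_subKernel_apply μ hA]
  exact lintegral_congr fun η => (ofReal_kTransform_indicator η hA hAb).symm

theorem IsCorrelationMeasure.unique {μ : Measure (Cone X)} {ρ ρ' : Measure (FinCone X)}
    (h : IsCorrelationMeasure μ ρ) (h' : IsCorrelationMeasure μ ρ') : ρ = ρ' := by
  ext A hA
  rw [measure_eq_iSup_exhaustion ρ, measure_eq_iSup_exhaustion ρ']
  refine iSup_congr fun k => ?_
  have hAk := hA.inter (measurableSet_exhaustion X k)
  have hb := (isBoundedFinCone_exhaustion X k).mono (inter_subset_right (s := A))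
  rw [h _ hAk hb, h' _ hAk hb]

theorem bind_subKernel_absolutelyContinuous {m : Measure (PosReal × X)} {π : Measure (Config X)}
    (hπ : IsPoissonMeasure m π) {μ : Measure (Cone X)}
    (hac : IsLocallyAbsolutelyContinuous μ (coneMeasure π)) :
    μ.bind subKernel ≪ lebesguePoisson m := by
  refine Measure.AbsolutelyContinuous.mk fun A hA h0 => ?_
  rw [measure_eq_iSup_exhaustion, ENNReal.iSup_eq_zero]
  intro k
  have hAk := hA.inter (measurableSet_exhaustion X k)
  have hmeas : Measurable fun η : Cone X => subKernel η (A ∩ exhaustion X k) :=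
    (Measure.measurable_coe hAk).comp measurable_subKernel
  have hset := preimage_proj_subKernel_ne_zero hAk inter_subset_right
  have h := hac (compactCovering X k) _ _ (isBoundedBorel_compactCovering X k)
    (by positivity) (one_div_add_two_lt k) {η | subKernel η (A ∩ exhaustion X k) ≠ 0}
    (hmeas (measurableSet_singleton 0).compl)
  rw [hset] at h
  rw [bind_subKernel_apply μ hAk, lintegral_eq_zero_iff hmeas]
  exact h (coneMeasure_exists_isSub_eq_zero hπ hAk (measure_mono_null inter_subset_left h0))

theorem sigmaFinite_bind_subKernel {μ : Measure (Cone X)} (hμ : HasFiniteLocalMoments μ) :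
    SigmaFinite (μ.bind subKernel) := by
  refine sigmaFinite_of_exhaustion fun k => ?_
  rw [bind_subKernel_apply μ (measurableSet_exhaustion X k)]
  refine (lintegral_mono fun η => subKernel_exhaustion_le η k).trans_lt ?_
  have hmeas := Cone.measurable_apply_of_isCompact (isCompact_compactCovering X k)
  rw [lintegral_finsetSum _ fun n _ => (hmeas.pow_const n).const_mul _]
  refine ENNReal.sum_lt_top.2 fun n _ => ?_
  rw [lintegral_const_mul _ (hmeas.pow_const n)]
  exact ENNReal.mul_lt_top (ENNReal.pow_lt_top ENNReal.ofReal_lt_top)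
    (hμ n _ (isBoundedBorel_compactCovering X k))

end Correlation

end DiscreteCone

theorem mainTheorem12 {X : Type*} [TopologicalSpace X] [PolishSpace X] [LocallyCompactSpace X]
    [MeasurableSpace X] [BorelSpace X]
    (ν : Measure DiscreteCone.PosReal) [IsLocallyFiniteMeasure ν] [NullSingletonClass ν]
    (σ : Measure X) [IsLocallyFiniteMeasure σ] [NullSingletonClass σ]
    (hν : ∀ n : ℕ, 1 ≤ n → ∫⁻ s, ENNReal.ofReal (s : ℝ) ^ n ∂ν < ∞)
    (π : Measure (DiscreteCone.Config X)) (hπ : DiscreteCone.IsPoissonMeasure (ν.prod σ) π)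
    (μ : Measure (DiscreteCone.Cone X)) [IsProbabilityMeasure μ]
    (hμ : DiscreteCone.HasFiniteLocalMoments μ)
    (hac : DiscreteCone.IsLocallyAbsolutelyContinuous μ (DiscreteCone.coneMeasure π)) :
    (∃! ρ : Measure (DiscreteCone.FinCone X), DiscreteCone.IsCorrelationMeasure μ ρ) ∧
      ∀ ρ : Measure (DiscreteCone.FinCone X), DiscreteCone.IsCorrelationMeasure μ ρ →
        ρ ≪ DiscreteCone.lebesguePoisson (ν.prod σ) ∧
          ∃ k : DiscreteCone.FinCone X → ℝ≥0, Measurable k ∧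
            ρ = (DiscreteCone.lebesguePoisson (ν.prod σ)).withDensity fun ξ => (k ξ : ℝ≥0∞) := by
  have hcorr := DiscreteCone.isCorrelationMeasure_bind_subKernel μ
  -- By uniqueness, the remaining claims need proof only for `μ.bind subKernel`.
  refine ⟨⟨_, hcorr, fun ρ hρ => hρ.unique hcorr⟩, fun ρ hρ => ?_⟩
  obtain rfl := hρ.unique hcorr
  have hρac := DiscreteCone.bind_subKernel_absolutelyContinuous hπ hac
  have hρσ := DiscreteCone.sigmaFinite_bind_subKernel hμ
  have hlσ := DiscreteCone.sigmaFinite_lebesguePoisson (ν.prod σ)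
  set ρ := μ.bind DiscreteCone.subKernel
  set l := DiscreteCone.lebesguePoisson (ν.prod σ)
  refine ⟨hρac, fun ξ => (ρ.rnDeriv l ξ).toNNReal, (ρ.measurable_rnDeriv l).ennreal_toNNReal, ?_⟩
  rw [← Measure.withDensity_rnDeriv_eq ρ l hρac]
  refine withDensity_congr_ae ?_
  filter_upwards [ρ.rnDeriv_lt_top l] with ξ hξ
  -- The earlier rewrite also replaced the `ρ` inside the derivative on the right; this undoes it.
  -- Almost everywhere finiteness of the derivative makes `toNNReal` harmless.
  rw [Measure.withDensity_rnDeriv_eq ρ l hρac, ENNReal.coe_toNNReal hξ.ne]
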